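/- Let $\mathcal A_1,\mathcal A_4$ be commuting von Neumann algebras on a complex Hilbert space $H$, and let $\omega=\langle\Omega_0,\cdot\,\Omega_0\rangle$ be the vacuum state, given by a unit vector $\Omega_0\in H$ that is separating for $\mathcal A_1$ and for $\mathcal A_4$. Let the vector $\Omega\in H$ be cyclic for $\mathcal A_1\vee\mathcal A_4=(\mathcal A_1\cup\mathcal A_4)''$ and implement a pure state $\langle\Omega,\cdot\,\Omega\rangle$ of $B(H)$ that restricts to the product of the vacua, i.e. $\langle\Omega,ab\,\Omega\rangle=\omega(a)\,\omega(b)$ for all $a\in\mathcal A_1$, $b\in\mathcal A_4$. Let $J_{23}$ be the modular conjugation of the commutant $\mathcal A_{23}=(\mathcal A_1\vee\mathcal A_4)'$ with respect to $\Omega$, put $\mathcal A_2=J_{23}\mathcal A_1J_{23}$ and $\mathcal A_3=J_{23}\mathcal A_4J_{23}$, and assume that the Doplicher–Longo algebra $\mathcal A_{12}=\mathcal A_1\vee\mathcal A_2$ is a factor. Then $\Omega$ is also separating for $\mathcal A_1\vee\mathcal A_4$. There is a unitary identification $H=H_{12}\otimes H_{34}$ with Hilbert spaces $H_{12},H_{34}$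 such that $\mathcal A_{12}=B(H_{12})\otimes 1$, $\mathcal A_i=\mathcal N_i\otimes 1$ for $i=1,2$ and $\mathcal A_i=1\otimes\mathcal N_i$ for $i=3,4$ with von Neumann algebras $\mathcal N_1,\mathcal N_2$ on $H_{12}$ and $\mathcal N_3,\mathcal N_4$ on $H_{34}$, and $\Omega=\Omega_{12}\otimes\Omega_{34}$ with unit vectors $\Omega_{12}$, cyclic and separating for $\mathcal N_2$, and $\Omega_{34}$, cyclic and separating for $\mathcal N_3$. If $J_2$ is the modular conjugation of $\mathcal N_2$ with respect to $\Omega_{12}$ and $J_3$ that of $\mathcal N_3$ with respect to $\Omega_{34}$, then $$J_{23}=J_2\otimes J_3,\qquad J_2\mathcal N_2J_2=\mathcal N_1,\qquad J_3\mathcal N_3J_3=\mathcal N_4 .$$ Moreover the state $\langle\Omega,\cdot\,\Omega\rangle$ is pure on $\mathcal A_{12}$, so that $\mathcal A_{12}$, a factor of type I, has von Neumann entropy $0$ in this state, which is the minimal possible value. -/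

import Mathlib

open scoped InnerProductSpace TensorProduct ComplexConjugate ENNReal NNReal

universe u

noncomputable section

namespace DoplicherLongo

variable {H : Type u} [NormedAddCommGroup H] [InnerProductSpace ℂ H] [CompleteSpace H]

/-! ### Von Neumann algebras -/

/-- The von Neumann algebra `(S ∪ S*)''` generated by a set `S` of bounded operators. -/
def generated (S : Set (H →L[ℂ] H)) : VonNeumannAlgebra H :=
  VonNeumannAlgebra.commutant
    { toStarSubalgebra := StarSubalgebra.centralizer ℂ S
      centralizer_centralizer' := by
        change Set.centralizer (Set.centralizer (Set.centralizer (S ∪ star S)))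
          = Set.centralizer (S ∪ star S)
        simp }

/-- The von Neumann algebra `A ∨ B` generated by two von Neumann algebras. -/
def join (A B : VonNeumannAlgebra H) : VonNeumannAlgebra H :=
  generated ((A : Set (H →L[ℂ] H)) ∪ (B : Set (H →L[ℂ] H)))

/-- `M` is a factor: its center consists of the scalars. -/
def IsFactor (M : VonNeumannAlgebra H) : Prop :=
  ∀ T : H →L[ℂ] H, T ∈ M → T ∈ M.commutant → ∃ c : ℂ, T = c • (1 : H →L[ℂ] H)

/-- The vector `Ω` is cyclic for `M`: `M Ω` is dense. -/
def IsCyclic (M : VonNeumannAlgebra H) (Ω : H) : Prop :=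
  Dense {x : H | ∃ a ∈ M, x = a Ω}

/-- The vector `Ω` is separating for `M`. -/
def IsSeparating (M : VonNeumannAlgebra H) (Ω : H) : Prop :=
  ∀ a ∈ M, a Ω = 0 → a = 0

/-! ### Modular conjugations -/

/-- The graph of the closed Tomita operator of `(M, Ω)`, that is, of the closure of the
conjugate-linear operator `a Ω ↦ a* Ω`, `a ∈ M`. -/
def tomitaGraph (M : VonNeumannAlgebra H) (Ω : H) : Set (H × H) :=
  closure {p : H × H | ∃ a ∈ M, p = (a Ω, (star a) Ω)}

/-- The antiunitary operator `J` is the modular conjugation of `M` with respect to (the cyclic and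
separating vector) `Ω`: the closed Tomita operator has the polar decomposition `S = J P` with `P`
positive and self-adjoint (so that `P` is the square root of the modular operator). -/
def IsModularConjugation (M : VonNeumannAlgebra H) (Ω : H) (J : H ≃ₗᵢ⋆[ℂ] H) : Prop :=
  ∃ P : H →ₗ.[ℂ] H, IsSelfAdjoint P ∧ (∀ x : P.domain, 0 ≤ (⟪(x : H), P x⟫_ℂ).re) ∧
    ∀ x y : H, (x, y) ∈ tomitaGraph M Ω ↔ ∃ hx : x ∈ P.domain, y = J (P ⟨x, hx⟩)

/-- The bounded linear operator `J a J`, for an antiunitary operator `J`. -/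
def sandwich (J : H ≃ₗᵢ⋆[ℂ] H) (a : H →L[ℂ] H) : H →L[ℂ] H :=
  (J.toContinuousLinearEquiv : H →L⋆[ℂ] H).comp
    (a.comp (J.toContinuousLinearEquiv : H →L⋆[ℂ] H))

/-- The algebra `J A J` (generated by the operators `J a J`, `a ∈ A`). -/
def conjugate (J : H ≃ₗᵢ⋆[ℂ] H) (A : VonNeumannAlgebra H) : VonNeumannAlgebra H :=
  generated (sandwich J '' (A : Set (H →L[ℂ] H)))

/-! ### Hilbert space tensor products -/

/-- The Hilbert space tensor product: the completion of the algebraic one. -/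
abbrev HilbertTensor (H₁ H₂ : Type u) [NormedAddCommGroup H₁] [InnerProductSpace ℂ H₁]
    [NormedAddCommGroup H₂] [InnerProductSpace ℂ H₂] : Type u :=
  UniformSpace.Completion (H₁ ⊗[ℂ] H₂)

/-- The elementary tensor `x ⊗ y` in the Hilbert space tensor product. -/
def tmul {H₁ H₂ : Type u} [NormedAddCommGroup H₁] [InnerProductSpace ℂ H₁]
    [NormedAddCommGroup H₂] [InnerProductSpace ℂ H₂] (x : H₁) (y : H₂) : HilbertTensor H₁ H₂ :=
  ((x ⊗ₜ[ℂ] y : H₁ ⊗[ℂ] H₂) : UniformSpace.Completion (H₁ ⊗[ℂ] H₂))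

section Tensor

variable {H₁ H₂ : Type u} [NormedAddCommGroup H₁] [InnerProductSpace ℂ H₁]
  [NormedAddCommGroup H₂] [InnerProductSpace ℂ H₂]

/-- The operators on `H` that are of the form `a ⊗ 1`, `a ∈ N`, when `H` is identified with
`H₁ ⊗ H₂` through the unitary `W`. -/
def leftAmpl (W : HilbertTensor H₁ H₂ ≃ₗᵢ[ℂ] H) (N : Set (H₁ →L[ℂ] H₁)) : Set (H →L[ℂ] H) :=
  {T | ∃ a ∈ N, ∀ x y, T (W (tmul x y)) = W (tmul (a x) y)}

/-- The operators on `H` that are of the form `1 ⊗ b`, `b ∈ N`, when `H` is identified with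
`H₁ ⊗ H₂` through the unitary `W`. -/
def rightAmpl (W : HilbertTensor H₁ H₂ ≃ₗᵢ[ℂ] H) (N : Set (H₂ →L[ℂ] H₂)) : Set (H →L[ℂ] H) :=
  {T | ∃ b ∈ N, ∀ x y, T (W (tmul x y)) = W (tmul x (b y))}

/-- `J = J₁ ⊗ J₂` for antiunitary operators, when `H` is identified with `H₁ ⊗ H₂` through the
unitary `W`. -/
def IsTensorConj (W : HilbertTensor H₁ H₂ ≃ₗᵢ[ℂ] H) (J : H ≃ₗᵢ⋆[ℂ] H) (J₁ : H₁ ≃ₗᵢ⋆[ℂ] H₁)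
    (J₂ : H₂ ≃ₗᵢ⋆[ℂ] H₂) : Prop :=
  ∀ x y, J (W (tmul x y)) = W (tmul (J₁ x) (J₂ y))

end Tensor

/-! ### States and entropy -/

/-- The set of states of `M`: the positive normalized linear functionals. -/
def states (M : VonNeumannAlgebra H) : Set (M.toStarSubalgebra →ₗ[ℂ] ℂ) :=
  {φ | φ 1 = 1 ∧ ∀ a, 0 ≤ (φ (star a * a)).re ∧ (φ (star a * a)).im = 0}

/-- The functional `a ↦ ⟨Ω, a Ω⟩` on `M`. -/
def vectorState (M : VonNeumannAlgebra H) (Ω : H) : M.toStarSubalgebra →ₗ[ℂ] ℂ where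
  toFun a := ⟪Ω, (a : H →L[ℂ] H) Ω⟫_ℂ
  map_add' a b := by simp
  map_smul' c a := by simp

/-- `φ` is a pure state of `M`: an extreme point of the set of states. -/
def IsPureState (M : VonNeumannAlgebra H) (φ : M.toStarSubalgebra →ₗ[ℂ] ℂ) : Prop :=
  φ ∈ Set.extremePoints ℝ (states M)

/-- `M` is a factor of type I, identified with all bounded operators on some Hilbert space `K`, the
state `φ` is given there by the density matrix `ρ = ∑ i, p i |b i⟩⟨b i|` with orthonormal
eigenvectors `b i` and eigenvalues `p i`, that is `φ (T) = Tr (ρ T)`, and its von Neumann entropy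
`- Tr (ρ log ρ) = ∑ i, - p i log (p i)`, a value in `[0, ∞]`, is `s`. -/
def HasEntropy (M : VonNeumannAlgebra H) (φ : M.toStarSubalgebra →ₗ[ℂ] ℂ) (s : ℝ≥0∞) : Prop :=
  ∃ (K : Type u) (_ : NormedAddCommGroup K) (_ : InnerProductSpace ℂ K) (_ : CompleteSpace K)
    (π : (K →L[ℂ] K) ≃⋆ₐ[ℂ] M.toStarSubalgebra)
    (ι : Type u) (b : HilbertBasis ι ℂ K) (p : ι → ℝ),
    (∀ i, 0 ≤ p i) ∧ HasSum p 1 ∧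
    (∀ T : K →L[ℂ] K, HasSum (fun i => (p i : ℂ) * ⟪b i, T (b i)⟫_ℂ) (φ (π T))) ∧
    s = ∑' i, ENNReal.ofReal (Real.negMulLog (p i))

end DoplicherLongo

end

/-! The product state splits `H` into the tensor product of the closures of `A₁ Ω` and `A₄ Ω`: the
map `aΩ ⊗ bΩ ↦ abΩ` is isometric because the state factorises, and has dense range because `Ω` is
cyclic (`exists_tensor`). `A₁` and `A₄` then act on separate factors and `Ω` is a product vector.

The modular theory of `(A₁ ∨ A₄)'` respects this splitting. Slices of that commutant lie in the
commutant of the reduction of `A₁`, so the projection `E = 1 ⊗ |Ω₃₄⟩⟨Ω₃₄|` maps the graph of the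
closed Tomita operator `S` into itself. By uniqueness of the polar decomposition `J₂₃` commutes with
`E`, hence restricts to an antiunitary `J₂` of the first factor, and likewise to `J₃` on the second.
If `P₁`, `P₂` are the positive parts of the restricted Tomita operators, then `S = (J₂ ⊗ J₃)(P₁ ⊗
P₂)`, and uniqueness gives `J₂₃ = J₂ ⊗ J₃` (`conj_tensor`).

The analytic input is the duality `S_N = (S_{N'})*` (`mem_tomitaGraph_of_adjoint`). Tomita's theorem
`J M J = M'` is not needed: if `S_{N'} = J P`, then `S_N = P J`, so the Tomita operator of `J N J`
is `J (P J) J = J P`, with the same conjugation `J` (`of_sandwich`).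

An operator `x` for which `x` and `J₂ x J₂` both commute with `N₁` satisfies `J₂ x J₂ = x*`; as
conjugation by `J₂` preserves products and the adjoint reverses them, all such `x` commute. Slices
of `A₁₂'` are of this kind, so their amplifications are central in `A₁₂`. For a factor they are
scalars, and `A₁₂` is all of `B(H₁₂) ⊗ 1` (`mem_join_conjugate`). There `Ω` induces the vector state
of `Ω₁₂`, which is pure with a rank-one density matrix.

Unbounded positive operators `P` are treated as self-adjoint relations and controlled by the bounded
operators `(1 + P²)⁻¹` and `P (1 + P²)⁻¹`. -/

namespace DoplicherLongo

set_option linter.unusedSectionVars false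

/-! ### Positive self-adjoint relations and uniqueness of polar decompositions -/

section SelfAdjointRelations

variable {H : Type u} [NormedAddCommGroup H] [InnerProductSpace ℂ H] [CompleteSpace H]

theorem eq_zero_of_inner_self_add_inner_self {x y : H} (h : ⟪x, x⟫_ℂ + ⟪y, y⟫_ℂ = 0) :
    x = 0 ∧ y = 0 := by
  have h' := congrArg Complex.re h
  have e1 : (⟪x, x⟫_ℂ).re = ‖x‖ ^ 2 := inner_self_eq_norm_sq (𝕜 := ℂ) x
  have e2 : (⟪y, y⟫_ℂ).re = ‖y‖ ^ 2 := inner_self_eq_norm_sq (𝕜 := ℂ) y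
  rw [Complex.add_re, e1, e2, Complex.zero_re] at h'
  exact ⟨norm_eq_zero.1 (by nlinarith [sq_nonneg ‖x‖, sq_nonneg ‖y‖]),
    norm_eq_zero.1 (by nlinarith [sq_nonneg ‖x‖, sq_nonneg ‖y‖])⟩

/-- The orthogonal projection of `H × H` (with its Hilbert space structure) onto a closed subspace,
as a matrix of operators. -/
theorem exists_block_projection (K : Submodule ℂ (H × H)) (hK : IsClosed (K : Set (H × H))) :
    ∃ p q r s : H →L[ℂ] H, (∀ h k, (p h + r k, q h + s k) ∈ K) ∧
      ∀ h k, ∀ z ∈ K, ⟪z.1, h - (p h + r k)⟫_ℂ + ⟪z.2, k - (q h + s k)⟫_ℂ = 0 := by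
  let e := WithLp.prodContinuousLinearEquiv 2 ℂ H H
  let K' : Submodule ℂ (WithLp 2 (H × H)) := K.comap e.toLinearEquiv.toLinearMap
  have hK' : IsClosed (K' : Set (WithLp 2 (H × H))) := hK.preimage e.continuous
  have : CompleteSpace K' := hK'.completeSpace_coe
  let Q : H × H →L[ℂ] H × H :=
    (e : WithLp 2 (H × H) →L[ℂ] H × H).comp
      (K'.starProjection.comp (e.symm : H × H →L[ℂ] WithLp 2 (H × H)))
  have hQ : ∀ z, Q z ∈ K := fun z => by
    have : K'.starProjection (e.symm z) ∈ K' := K'.starProjection_apply_mem _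
    exact this
  have hQ' : ∀ z, ∀ w ∈ K, ⟪w.1, z.1 - (Q z).1⟫_ℂ + ⟪w.2, z.2 - (Q z).2⟫_ℂ = 0 := by
    intro z w hw
    have h1 : e.symm z - K'.starProjection (e.symm z) ∈ K'ᗮ :=
      K'.sub_starProjection_mem_orthogonal _
    have h2 : e.symm w ∈ K' := by
      change e (e.symm w) ∈ K
      simpa using hw
    have h3 := (K'.mem_orthogonal _).1 h1 _ h2
    rw [WithLp.prod_inner_apply] at h3
    exact h3
  refine ⟨(ContinuousLinearMap.fst ℂ H H).comp (Q.comp (ContinuousLinearMap.inl ℂ H H)),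
    (ContinuousLinearMap.snd ℂ H H).comp (Q.comp (ContinuousLinearMap.inl ℂ H H)),
    (ContinuousLinearMap.fst ℂ H H).comp (Q.comp (ContinuousLinearMap.inr ℂ H H)),
    (ContinuousLinearMap.snd ℂ H H).comp (Q.comp (ContinuousLinearMap.inr ℂ H H)), ?_⟩
  have hs : ∀ h k, Q (h, k) = Q (h, 0) + Q (0, k) := fun h k => by
    rw [← map_add]; simp
  constructor
  · intro h k
    have := hQ (h, k)
    rw [hs] at this
    exact this
  · intro h k z hz
    have := hQ' (h, k) z hz
    rw [hs] at this
    exact this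

/-- A vector of a closed subspace with orthogonal residual is the projection. -/
theorem block_projection_unique {K : Submodule ℂ (H × H)} {p q r s : H →L[ℂ] H}
    (h1 : ∀ h k, (p h + r k, q h + s k) ∈ K)
    (h2 : ∀ h k, ∀ z ∈ K, ⟪z.1, h - (p h + r k)⟫_ℂ + ⟪z.2, k - (q h + s k)⟫_ℂ = 0)
    {h k x y : H} (hm : (x, y) ∈ K)
    (ho : ∀ z ∈ K, ⟪z.1, h - x⟫_ℂ + ⟪z.2, k - y⟫_ℂ = 0) :
    p h + r k = x ∧ q h + s k = y := by
  have hd : (p h + r k - x, q h + s k - y) ∈ K := K.sub_mem (h1 h k) hm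
  have a := h2 h k _ hd
  have b := ho _ hd
  have c : ⟪p h + r k - x, p h + r k - x⟫_ℂ + ⟪q h + s k - y, q h + s k - y⟫_ℂ = 0 := by
    have e1 : p h + r k - x = (h - x) - (h - (p h + r k)) := by abel
    have e2 : q h + s k - y = (k - y) - (k - (q h + s k)) := by abel
    calc _ = (⟪p h + r k - x, h - x⟫_ℂ + ⟪q h + s k - y, k - y⟫_ℂ)
        - (⟪p h + r k - x, h - (p h + r k)⟫_ℂ + ⟪q h + s k - y, k - (q h + s k)⟫_ℂ) := by
          conv_lhs => rw [show ⟪p h + r k - x, p h + r k - x⟫_ℂ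
            = ⟪p h + r k - x, (h - x) - (h - (p h + r k))⟫_ℂ by rw [← e1],
            show ⟪q h + s k - y, q h + s k - y⟫_ℂ
            = ⟪q h + s k - y, (k - y) - (k - (q h + s k))⟫_ℂ by rw [← e2]]
          rw [inner_sub_right (p h + r k - x), inner_sub_right (q h + s k - y)]
          ring
      _ = 0 := by rw [a, b]; simp
  obtain ⟨c1, c2⟩ := eq_zero_of_inner_self_add_inner_self c
  exact ⟨sub_eq_zero.1 c1, sub_eq_zero.1 c2⟩

/-- A positive self-adjoint linear relation in `H`. -/
structure IsPosRel (G : Set (H × H)) : Prop where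
  mem_iff : ∀ x y, (x, y) ∈ G ↔ ∀ z ∈ G, ⟪x, z.2⟫_ℂ = ⟪y, z.1⟫_ℂ
  nonneg : ∀ z ∈ G, 0 ≤ (⟪z.1, z.2⟫_ℂ).re

namespace IsPosRel

variable {G : Set (H × H)}

theorem symm (hG : IsPosRel G) {x y u v : H} (h : (x, y) ∈ G) (h' : (u, v) ∈ G) :
    ⟪x, v⟫_ℂ = ⟪y, u⟫_ℂ := (hG.mem_iff x y).1 h _ h'

/-- Equality with the adjoint relation makes `G` an intersection of closed linear conditions;
closedness and linearity therefore need not be assumed. -/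
theorem isClosed (hG : IsPosRel G) : IsClosed G := by
  have : G = ⋂ z ∈ G, {w : H × H | ⟪w.1, z.2⟫_ℂ = ⟪w.2, z.1⟫_ℂ} := by
    ext ⟨x, y⟩
    simp only [Set.mem_iInter]
    exact hG.mem_iff x y
  rw [this]
  exact isClosed_biInter fun z _ => isClosed_eq (by fun_prop) (by fun_prop)

theorem zero_mem (hG : IsPosRel G) : ((0 : H), (0 : H)) ∈ G := by
  rw [hG.mem_iff]; simp

theorem add_mem (hG : IsPosRel G) {x y u v : H} (h : (x, y) ∈ G) (h' : (u, v) ∈ G) :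
    (x + u, y + v) ∈ G := by
  rw [hG.mem_iff]
  intro z hz
  rw [inner_add_left, inner_add_left, (hG.mem_iff x y).1 h z hz, (hG.mem_iff u v).1 h' z hz]

theorem smul_mem (hG : IsPosRel G) (c : ℂ) {x y : H} (h : (x, y) ∈ G) : (c • x, c • y) ∈ G := by
  rw [hG.mem_iff]
  intro z hz
  rw [inner_smul_left, inner_smul_left, (hG.mem_iff x y).1 h z hz]

theorem sub_mem (hG : IsPosRel G) {x y u v : H} (h : (x, y) ∈ G) (h' : (u, v) ∈ G) :
    (x - u, y - v) ∈ G := by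
  have := hG.add_mem h (hG.smul_mem (-1) h')
  simpa [sub_eq_add_neg] using this

/-- A positive self-adjoint relation as a subspace. -/
def toSubmodule (hG : IsPosRel G) : Submodule ℂ (H × H) where
  carrier := G
  zero_mem' := hG.zero_mem
  add_mem' := fun {a b} ha hb => hG.add_mem (x := a.1) (y := a.2) (u := b.1) (v := b.2) ha hb
  smul_mem' := fun c z hz => hG.smul_mem c (x := z.1) (y := z.2) hz

/-- Positivity applied to `(x - y, y - x)` gives `-‖x - y‖² ≥ 0`. This elementary fact identifies `J
Ω` with `Ω` and later `J x J` with `x*`. -/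
theorem eq_of_swap_mem (hG : IsPosRel G) {x y : H} (h : (x, y) ∈ G) (h' : (y, x) ∈ G) : x = y := by
  have h1 := hG.nonneg _ (hG.sub_mem h h')
  simp only at h1
  rw [← neg_sub x y, inner_neg_right, inner_self_eq_norm_sq_to_K] at h1
  have h2 : 0 ≤ -(‖x - y‖ ^ 2) := by
    have : (-((‖x - y‖ : ℂ) ^ 2)).re = -(‖x - y‖ ^ 2) := by
      rw [← Complex.ofReal_pow, ← Complex.ofReal_neg, Complex.ofReal_re]
    rw [← this]; exact h1
  have h3 : ‖x - y‖ = 0 := by nlinarith [sq_nonneg ‖x - y‖]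
  exact sub_eq_zero.1 (norm_eq_zero.1 h3)

/-- The bounded operators `B = (1 + P²)⁻¹` and `C = P (1 + P²)⁻¹` of a positive self-adjoint
relation `P`. -/
theorem exists_resolvent (hG : IsPosRel G) : ∃ B C : H →L[ℂ] H,
    IsSelfAdjoint B ∧ IsSelfAdjoint C ∧ 0 ≤ C ∧
      (∀ h, (B h, C h) ∈ G) ∧ (∀ h, (C h, h - B h) ∈ G) := by
  obtain ⟨p, q, r, s, h1, h2⟩ := exists_block_projection hG.toSubmodule hG.isClosed
  have hB : ∀ h, (p h, q h) ∈ G := fun h => by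
    have := h1 h 0
    simp only [map_zero, add_zero] at this
    exact this
  -- The residual `(h - p h, -q h)` is orthogonal to the graph, which is precisely membership of `(q
  -- h, h - p h)` in the adjoint relation, that is, in `G`.
  have hC : ∀ h, (q h, h - p h) ∈ G := fun h => by
    rw [hG.mem_iff]
    intro z hz
    have := h2 h 0 z hz
    simp only [map_zero, add_zero, zero_sub, inner_neg_right] at this
    rw [← inner_conj_symm (q h), ← inner_conj_symm (h - p h), sub_eq_zero.1 this]
  have hCC : ∀ h k, ⟪q h, q k⟫_ℂ = ⟪h - p h, p k⟫_ℂ := fun h k => hG.symm (hC h) (hB k)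
  have hCC' : ∀ h k, ⟪q h, q k⟫_ℂ = ⟪p h, k - p k⟫_ℂ := fun h k => (hG.symm (hB h) (hC k)).symm
  have sB : ∀ h k, ⟪p h, k⟫_ℂ = ⟪h, p k⟫_ℂ := fun h k => by
    have := (hCC h k).symm.trans (hCC' h k)
    rw [inner_sub_left, inner_sub_right] at this
    linear_combination -this
  have sC : ∀ h k, ⟪q h, k⟫_ℂ = ⟪h, q k⟫_ℂ := fun h k => by
    have a := hG.symm (hB h) (hB k)
    have b := hG.symm (hC h) (hC k)
    rw [inner_sub_left, inner_sub_right] at b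
    linear_combination b - a
  refine ⟨p, q, ?_, ?_, ?_, hB, hC⟩
  · exact (ContinuousLinearMap.isSelfAdjoint_iff_isSymmetric).2 sB
  · exact (ContinuousLinearMap.isSelfAdjoint_iff_isSymmetric).2 sC
  · rw [ContinuousLinearMap.nonneg_iff_isPositive, ContinuousLinearMap.isPositive_def]
    refine ⟨sC, fun h => ?_⟩
    rw [ContinuousLinearMap.reApplyInnerSelf_apply]
    have a := hG.nonneg _ (hB h)
    have b := hG.nonneg _ (hC h)
    rw [← inner_conj_symm] at a
    simp only [Complex.conj_re] at a
    have e : ⟪q h, h⟫_ℂ = ⟪q h, p h⟫_ℂ + ⟪q h, h - p h⟫_ℂ := by rw [inner_sub_right]; ring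
    rw [e]
    simp only [RCLike.re_to_complex, Complex.add_re]
    exact add_nonneg a b

/-- Symmetry gives `‖C h‖² = ⟪h - B h, B h⟫`, so `B h = 0` forces `C h = 0` and `(0, h) ∈ G`. -/
theorem eq_zero_of_resolvent (hG : IsPosRel G) (hsv : ∀ y, ((0 : H), y) ∈ G → y = 0)
    {B C : H →L[ℂ] H} (hB : ∀ h, (B h, C h) ∈ G) (hC : ∀ h, (C h, h - B h) ∈ G) {h : H}
    (h0 : B h = 0) : h = 0 := by
  have a := hG.symm (hC h) (hB h)
  rw [h0, inner_zero_right, inner_self_eq_zero] at a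
  have b := hC h
  rw [a, h0, sub_zero] at b
  exact hsv _ b

/-- A positive self-adjoint relation `{(x, V y)}` with `(x, y)` in a positive self-adjoint
operator and `V` isometric is that operator. -/
theorem eq_of_polar {G' : Set (H × H)} (hG : IsPosRel G) (hG' : IsPosRel G')
    (hsv : ∀ y, ((0 : H), y) ∈ G → y = 0) (V : H ≃ₗᵢ[ℂ] H)
    (hV : ∀ x y, (x, y) ∈ G ↔ (x, V y) ∈ G') {x y : H} (hxy : (x, y) ∈ G) : V y = y := by
  obtain ⟨B, C, sB, sC, pC, hB, hC⟩ := hG.exists_resolvent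
  obtain ⟨B', C', sB', sC', pC', hB', hC'⟩ := hG'.exists_resolvent
  have sB := ContinuousLinearMap.isSelfAdjoint_iff_isSymmetric.1 sB
  have sC := ContinuousLinearMap.isSelfAdjoint_iff_isSymmetric.1 sC
  have sC' := ContinuousLinearMap.isSelfAdjoint_iff_isSymmetric.1 sC'
  have kB : ∀ h, B h = 0 → h = 0 := fun h => hG.eq_zero_of_resolvent hsv hB hC
  -- the resolvents agree
  have key : ∀ h, B h = B' h ∧ V (C h) = C' h := by
    intro h
    have hVB : (B h, V (C h)) ∈ G' := (hV _ _).1 (hB h)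
    have hort : ∀ z ∈ G', ⟪z.1, h - B h⟫_ℂ = ⟪z.2, V (C h)⟫_ℂ := by
      intro z hz
      obtain ⟨z1, z2⟩ := z
      have hz' : (z1, V.symm z2) ∈ G := (hV _ _).2 (by simpa using hz)
      have := hG.symm hz' (hC h)
      simp only
      rw [this, ← V.inner_map_map, V.apply_symm_apply]
    have hort' : ∀ z ∈ G', ⟪z.1, h - B' h⟫_ℂ = ⟪z.2, C' h⟫_ℂ := fun z hz =>
      hG'.symm (x := z.1) (y := z.2) hz (hC' h)
    have hd := hG'.sub_mem hVB (hB' h)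
    have a := hort _ hd
    have b := hort' _ hd
    simp only at a b
    have c : ⟪B h - B' h, B h - B' h⟫_ℂ + ⟪V (C h) - C' h, V (C h) - C' h⟫_ℂ = 0 := by
      rw [inner_sub_right (V (C h) - C' h), ← a, ← b, ← inner_sub_right, ← inner_add_right]
      rw [show B h - B' h + (h - B h - (h - B' h)) = 0 by abel, inner_zero_right]
    obtain ⟨c1, c2⟩ := eq_zero_of_inner_self_add_inner_self c
    exact ⟨sub_eq_zero.1 c1, sub_eq_zero.1 c2⟩
  -- `V C = C'` with `V` isometric makes the squares equal; positivity of `C` and `C'` then forces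
  -- `C = C'` by uniqueness of square roots.
  have hsq : C * C = C' * C' := by
    ext h
    refine ext_inner_left ℂ fun k => ?_
    change ⟪k, C (C h)⟫_ℂ = ⟪k, C' (C' h)⟫_ℂ
    have e1 : ⟪C k, C h⟫_ℂ = ⟪k, C (C h)⟫_ℂ := sC k (C h)
    have e2 : ⟪C' k, C' h⟫_ℂ = ⟪k, C' (C' h)⟫_ℂ := sC' k (C' h)
    rw [← e1, ← e2, ← (key k).2, ← (key h).2, V.inner_map_map]
  have hCC : C = C' := by
    rw [← CFC.sqrt_unique rfl pC, ← CFC.sqrt_unique rfl pC', hsq]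
  -- Both `B y` and `B (V y)` equal `C x`, and `B` is injective.
  have e1 : B y = C x := by
    refine ext_inner_left ℂ fun k => ?_
    have a := hG.symm (hB k) hxy
    have b1 : ⟪B k, y⟫_ℂ = ⟪k, B y⟫_ℂ := sB k y
    have b2 : ⟪C k, x⟫_ℂ = ⟪k, C x⟫_ℂ := sC k x
    rw [← b1, ← b2, a]
  have e2 : B (V y) = C x := by
    refine ext_inner_left ℂ fun k => ?_
    have a := hG'.symm (hB' k) ((hV _ _).1 hxy)
    have b1 : ⟪B k, V y⟫_ℂ = ⟪k, B (V y)⟫_ℂ := sB k (V y)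
    have b2 : ⟪C k, x⟫_ℂ = ⟪k, C x⟫_ℂ := sC k x
    rw [← b1, ← b2, (key k).1, hCC, a]
  have := kB (V y - y) (by rw [map_sub, e1, e2, sub_self])
  exact sub_eq_zero.1 this

/-- Uniqueness of the polar decomposition of a conjugate-linear relation. -/
theorem conj_unique {G' : Set (H × H)} (hG : IsPosRel G) (hG' : IsPosRel G')
    (hsv : ∀ y, ((0 : H), y) ∈ G → y = 0) (hd : Dense {y | ∃ x, (x, y) ∈ G})
    (J J' : H ≃ₗᵢ⋆[ℂ] H) (h : ∀ x y, (x, J.symm y) ∈ G ↔ (x, J'.symm y) ∈ G') : J = J' := by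
  have hV : ∀ y ∈ {y | ∃ x, (x, y) ∈ G}, J'.symm (J y) = y := by
    rintro y ⟨x, hxy⟩
    refine hG.eq_of_polar hG' hsv (J.trans J'.symm) (fun x y => ?_) hxy
    simpa using h x (J y)
  have := Continuous.ext_on hd (f := fun y => J'.symm (J y)) (g := id)
    (J'.symm.continuous.comp J.continuous) continuous_id hV
  ext y
  have := congrFun this y
  simp only [id] at this
  conv_rhs => rw [← this]
  simp

end IsPosRel

/-- The graph of a positive self-adjoint operator. -/
theorem isPosRel_graph {P : H →ₗ.[ℂ] H} (hP : IsSelfAdjoint P)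
    (hpos : ∀ x : P.domain, 0 ≤ (⟪(x : H), P x⟫_ℂ).re) :
    IsPosRel {z : H × H | ∃ hx : z.1 ∈ P.domain, z.2 = P ⟨z.1, hx⟩} := by
  have hd := hP.dense_domain
  have hP' : P.adjoint = P := hP
  constructor
  · intro x y
    constructor
    · rintro ⟨hx, hy⟩ ⟨u, v⟩ ⟨hu, hv⟩
      simp only at hx hy hu hv ⊢
      rw [hy, hv]
      have := LinearPMap.adjoint_isFormalAdjoint hd
      rw [hP'] at this
      exact (this ⟨x, hx⟩ ⟨u, hu⟩).symm
    · intro h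
      have h' : ∀ u : P.domain, ⟪y, (u : H)⟫_ℂ = ⟪x, P u⟫_ℂ := fun u =>
        (h ((u : H), P u) ⟨u.2, rfl⟩).symm
      have hx : x ∈ P.adjoint.domain := P.mem_adjoint_domain_of_exists _ ⟨y, h'⟩
      have hy : P.adjoint ⟨x, hx⟩ = y := LinearPMap.adjoint_apply_eq hd ⟨x, hx⟩ h'
      have e : ∀ (R : H →ₗ.[ℂ] H), R = P → ∀ hx : x ∈ R.domain, R ⟨x, hx⟩ = y →
          ∃ hx : x ∈ P.domain, y = P ⟨x, hx⟩ := by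
        rintro R rfl hx rfl
        exact ⟨hx, rfl⟩
      exact e _ hP' hx hy
  · rintro ⟨x, y⟩ ⟨hx, hy⟩
    simp only at hx hy ⊢
    rw [hy]
    exact hpos ⟨x, hx⟩

/-- A densely defined single-valued positive self-adjoint relation is an operator. -/
theorem IsPosRel.exists_linearPMap {G : Set (H × H)} (hG : IsPosRel G)
    (hsv : ∀ y, ((0 : H), y) ∈ G → y = 0) (hdom : Dense {x | ∃ y, (x, y) ∈ G}) :
    ∃ P : H →ₗ.[ℂ] H, IsSelfAdjoint P ∧ (∀ x : P.domain, 0 ≤ (⟪(x : H), P x⟫_ℂ).re) ∧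
      ∀ x y : H, (x, y) ∈ G ↔ ∃ hx : x ∈ P.domain, y = P ⟨x, hx⟩ := by
  have hsv' : ∀ z ∈ hG.toSubmodule, z.1 = 0 → z.2 = 0 := by
    rintro ⟨x, y⟩ hz (rfl : x = 0)
    exact hsv y hz
  let P := hG.toSubmodule.toLinearPMap
  have hgr : P.graph = hG.toSubmodule := Submodule.toLinearPMap_graph_eq _ hsv'
  have hm : ∀ x y : H, (x, y) ∈ G ↔ ∃ hx : x ∈ P.domain, y = P ⟨x, hx⟩ := by
    intro x y
    have : (x, y) ∈ G ↔ (x, y) ∈ P.graph := by rw [hgr]; rfl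
    rw [this, LinearPMap.mem_graph_iff]
    constructor
    · rintro ⟨w, rfl, rfl⟩
      exact ⟨w.2, rfl⟩
    · rintro ⟨hx, rfl⟩
      exact ⟨⟨x, hx⟩, rfl, rfl⟩
  have hdP : Dense (P.domain : Set H) := by
    refine hdom.mono ?_
    rintro x ⟨y, hxy⟩
    exact ((hm x y).1 hxy).1
  refine ⟨P, ?_, ?_, hm⟩
  · rw [LinearPMap.isSelfAdjoint_def]
    refine LinearPMap.eq_of_eq_graph ?_
    ext ⟨x, y⟩
    have : (x, y) ∈ P.graph ↔ (x, y) ∈ G := by rw [hgr]; rfl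
    rw [this, LinearPMap.mem_graph_iff, hG.mem_iff]
    constructor
    · rintro ⟨w, rfl, rfl⟩ ⟨u, v⟩ huv
      obtain ⟨hu, rfl⟩ := (hm u v).1 huv
      exact (LinearPMap.adjoint_isFormalAdjoint hdP w ⟨u, hu⟩).symm
    · intro h
      have h' : ∀ u : P.domain, ⟪y, (u : H)⟫_ℂ = ⟪x, P u⟫_ℂ := fun u =>
        (h ((u : H), P u) ((hm _ _).2 ⟨u.2, rfl⟩)).symm
      have hx : x ∈ P.adjoint.domain := P.mem_adjoint_domain_of_exists _ ⟨y, h'⟩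
      exact ⟨⟨x, hx⟩, rfl, LinearPMap.adjoint_apply_eq hdP ⟨x, hx⟩ h'⟩
  · intro x
    exact hG.nonneg _ ((hm x (P x)).2 ⟨x.2, rfl⟩)

/-! ### Quotients of commuting bounded operators -/

section Quotient

variable {X Y : H →L[ℂ] H}

/-- The pairs `(X ζ, Y ζ)` are a core of the relation `{(z, w) | Y z = X w}`, for commuting
self-adjoint `X`, `Y` with `X` injective. -/
theorem mem_of_quotient_core (sX : ∀ z w, ⟪X z, w⟫_ℂ = ⟪z, X w⟫_ℂ)
    (sY : ∀ z w, ⟪Y z, w⟫_ℂ = ⟪z, Y w⟫_ℂ) (hXY : ∀ z, X (Y z) = Y (X z))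
    (kX : ∀ z, X z = 0 → z = 0) {S : Set (H × H)} (hS : IsClosed S)
    (hmem : ∀ ζ, (X ζ, Y ζ) ∈ S) {z w : H} (hzw : Y z = X w) : (z, w) ∈ S := by
  let R : Submodule ℂ (H × H) := LinearMap.range ((X.prod Y : H →L[ℂ] H × H) : H →ₗ[ℂ] H × H)
  have hRS : ∀ z ∈ R.topologicalClosure, z ∈ S := fun z hz =>
    closure_minimal (by rintro _ ⟨ζ, rfl⟩; exact hmem ζ) hS hz
  have hRQ : ∀ z ∈ R.topologicalClosure, Y z.1 = X z.2 := fun z hz =>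
    closure_minimal (t := {z : H × H | Y z.1 = X z.2})
      (by rintro _ ⟨ζ, rfl⟩; exact (hXY ζ).symm)
      (isClosed_eq (by fun_prop) (by fun_prop)) hz
  obtain ⟨p, q, r, s, h1, h2⟩ := exists_block_projection _ R.isClosed_topologicalClosure
  have hQ := hRQ _ (h1 z w)
  have ho : ∀ ζ, ⟪X ζ, z - (p z + r w)⟫_ℂ + ⟪Y ζ, w - (q z + s w)⟫_ℂ = 0 := fun ζ =>
    h2 z w _ (R.le_topologicalClosure ⟨ζ, rfl⟩)
  set u := z - (p z + r w) with hu
  set v := w - (q z + s w) with hv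
  -- The residual `(u, v)` of the projection onto the closed range of `(X, Y)` satisfies `Y u = X v`
  -- and `X u + Y v = 0`, so `(X² + Y²) u = 0`, and injectivity of `X` kills it.
  have e1 : Y u = X v := by rw [hu, hv, map_sub, map_sub, hzw, hQ]
  have e2 : X u + Y v = 0 := by
    refine ext_inner_left ℂ fun ζ => ?_
    rw [inner_add_right, ← sX, ← sY, ho, inner_zero_right]
  have e3 : ⟪X u, X u⟫_ℂ + ⟪Y u, Y u⟫_ℂ = 0 := by
    have : X (X u) + Y (Y u) = 0 := by
      rw [e1, ← hXY, ← map_add, e2, map_zero]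
    rw [sX, sY, ← inner_add_right, this, inner_zero_right]
  have hu0 : u = 0 := kX _ (eq_zero_of_inner_self_add_inner_self e3).1
  have hv0 : v = 0 := kX _ (by rw [← e1, hu0, map_zero])
  have := hRS _ (h1 z w)
  rwa [← sub_eq_zero.1 hu0, ← sub_eq_zero.1 hv0] at this

/-- The relation is the operator `Y X⁻¹`; symmetry and positivity only have to be verified on the
core of pairs `(X ζ, Y ζ)`. It serves to define the tensor product of two unbounded positive
operators. -/
theorem isPosRel_quotient (sX : ∀ z w, ⟪X z, w⟫_ℂ = ⟪z, X w⟫_ℂ)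
    (sY : ∀ z w, ⟪Y z, w⟫_ℂ = ⟪z, Y w⟫_ℂ) (hXY : ∀ z, X (Y z) = Y (X z))
    (kX : ∀ z, X z = 0 → z = 0) (hpos : ∀ ζ, 0 ≤ (⟪X ζ, Y ζ⟫_ℂ).re) :
    IsPosRel {z : H × H | Y z.1 = X z.2} := by
  constructor
  · intro x y
    constructor
    · intro hxy z hz
      refine mem_of_quotient_core (S := {z : H × H | ⟪x, z.2⟫_ℂ = ⟪y, z.1⟫_ℂ}) sX sY hXY kX
        (isClosed_eq (by fun_prop) (by fun_prop)) (fun ζ => ?_) (z := z.1) (w := z.2) hz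
      change ⟪x, Y ζ⟫_ℂ = ⟪y, X ζ⟫_ℂ
      rw [← sX, ← sY, show Y x = X y from hxy]
    · intro h
      change Y x = X y
      refine ext_inner_right ℂ fun ζ => ?_
      rw [sX, sY]
      exact h (X ζ, Y ζ) (hXY ζ).symm
  · intro z hz
    exact mem_of_quotient_core (S := {z : H × H | 0 ≤ (⟪z.1, z.2⟫_ℂ).re}) sX sY hXY kX
      (isClosed_le (by fun_prop) (by fun_prop)) hpos (z := z.1) (w := z.2) hz

end Quotient

end SelfAdjointRelations

/-! ### Closed Tomita operators and modular conjugations -/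

section Tomita

variable {H : Type u} [NormedAddCommGroup H] [InnerProductSpace ℂ H] [CompleteSpace H]

theorem antiunitary_inner (J : H ≃ₗᵢ⋆[ℂ] H) (x y : H) : ⟪J x, J y⟫_ℂ = ⟪y, x⟫_ℂ := by
  have hre : ∀ x y : H, (⟪J x, J y⟫_ℂ).re = (⟪x, y⟫_ℂ).re := by
    intro x y
    have h1 := norm_add_sq (𝕜 := ℂ) x y
    have h2 := norm_add_sq (𝕜 := ℂ) (J x) (J y)
    rw [← map_add, J.norm_map, J.norm_map, J.norm_map] at h2
    simp only [RCLike.re_to_complex] at h1 h2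
    linarith
  have h1 := hre x y
  have h2 := hre x (Complex.I • y)
  rw [J.map_smulₛₗ, inner_smul_right, inner_smul_right] at h2
  simp only [Complex.conj_I, Complex.mul_re, Complex.neg_re, Complex.I_re, Complex.neg_im,
    Complex.I_im] at h2
  rw [← inner_conj_symm y x]
  apply Complex.ext
  · rw [h1, Complex.conj_re]
  · simp only [Complex.conj_im]; linarith

theorem antiunitary_inner_left (J : H ≃ₗᵢ⋆[ℂ] H) (x y : H) : ⟪J x, y⟫_ℂ = ⟪J.symm y, x⟫_ℂ := by
  rw [← antiunitary_inner J x, J.apply_symm_apply]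

/-- For `G` the graph of `P` this is `K⁻¹ P⁻¹ K`, the positive part that appears when a polar
decomposition is inverted. -/
theorem IsPosRel.swap_conj {G : Set (H × H)} (hG : IsPosRel G) (K : H ≃ₗᵢ⋆[ℂ] H) :
    IsPosRel {z : H × H | (K z.2, K z.1) ∈ G} := by
  constructor
  · intro x y
    change (K y, K x) ∈ G ↔ _
    rw [hG.mem_iff]
    constructor
    · rintro h ⟨u, v⟩ huv
      have := h _ huv
      simp only [antiunitary_inner] at this
      simp only
      rw [← inner_conj_symm, ← this, inner_conj_symm]
    · rintro h ⟨u, v⟩ huv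
      have := h (K.symm v, K.symm u) (by simpa using huv)
      simp only at this ⊢
      rw [antiunitary_inner_left K y, antiunitary_inner_left K x, ← inner_conj_symm, ← this,
        inner_conj_symm]
  · rintro ⟨x, y⟩ h
    have := hG.nonneg _ h
    simp only [antiunitary_inner] at this
    exact this

theorem IsPosRel.comap {G : Set (H × H)} (hG : IsPosRel G) (U : H ≃ₗᵢ[ℂ] H) :
    IsPosRel {z : H × H | (U z.1, U z.2) ∈ G} := by
  constructor
  · intro x y
    change (U x, U y) ∈ G ↔ _
    rw [hG.mem_iff]
    constructor
    · rintro h ⟨u, v⟩ huv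
      have := h _ huv
      simpa only [U.inner_map_map] using this
    · rintro h ⟨u, v⟩ huv
      have := h (U.symm u, U.symm v) (by simpa using huv)
      simp only at this ⊢
      rw [← U.inner_map_map x, ← U.inner_map_map y, U.apply_symm_apply, U.apply_symm_apply] at this
      exact this
  · rintro ⟨x, y⟩ h
    have := hG.nonneg _ h
    simpa only [U.inner_map_map] using this

variable {M : VonNeumannAlgebra H} {Ω : H}

theorem star_apply_inner (a : H →L[ℂ] H) (x y : H) : ⟪(star a) x, y⟫_ℂ = ⟪x, a y⟫_ℂ :=
  ContinuousLinearMap.adjoint_inner_left a y x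

theorem inner_star_apply (a : H →L[ℂ] H) (x y : H) : ⟪x, (star a) y⟫_ℂ = ⟪a x, y⟫_ℂ :=
  ContinuousLinearMap.adjoint_inner_right a x y

theorem mem_tomitaGraph {a : H →L[ℂ] H} (ha : a ∈ M) : (a Ω, (star a) Ω) ∈ tomitaGraph M Ω :=
  subset_closure ⟨a, ha, rfl⟩

theorem isClosed_tomitaGraph : IsClosed (tomitaGraph M Ω) := isClosed_closure

theorem tomitaGraph_subset {S : Set (H × H)} (hS : IsClosed S)
    (h : ∀ a ∈ M, (a Ω, (star a) Ω) ∈ S) : tomitaGraph M Ω ⊆ S :=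
  closure_minimal (by rintro _ ⟨a, ha, rfl⟩; exact h a ha) hS

theorem tomitaGraph_swap {x y : H} (h : (x, y) ∈ tomitaGraph M Ω) : (y, x) ∈ tomitaGraph M Ω := by
  refine tomitaGraph_subset (S := {z | (z.2, z.1) ∈ tomitaGraph M Ω})
    (isClosed_tomitaGraph.preimage (by fun_prop)) (fun a ha => ?_) h
  have := mem_tomitaGraph (Ω := Ω) (star_mem ha)
  rwa [star_star] at this

theorem tomitaGraph_add {x y u v : H} (h : (x, y) ∈ tomitaGraph M Ω)
    (h' : (u, v) ∈ tomitaGraph M Ω) : (x + u, y + v) ∈ tomitaGraph M Ω := by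
  have := map_mem_closure₂ (f := fun z w : H × H => z + w) continuous_add h h'
    (u := {p : H × H | ∃ a ∈ M, p = (a Ω, (star a) Ω)}) ?_
  · exact this
  · rintro _ ⟨a, ha, rfl⟩ _ ⟨b, hb, rfl⟩
    exact ⟨a + b, add_mem ha hb, by simp⟩

theorem tomitaGraph_smul (r : ℂ) {x y : H} (h : (x, y) ∈ tomitaGraph M Ω) :
    (r • x, conj r • y) ∈ tomitaGraph M Ω := by
  refine tomitaGraph_subset (S := {z | (r • z.1, conj r • z.2) ∈ tomitaGraph M Ω})
    (isClosed_tomitaGraph.preimage (by fun_prop)) (fun a ha => ?_) h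
  have := mem_tomitaGraph (Ω := Ω) (M.toStarSubalgebra.smul_mem ha r)
  rw [star_smul] at this
  exact this

theorem tomitaGraph_sub {x y u v : H} (h : (x, y) ∈ tomitaGraph M Ω)
    (h' : (u, v) ∈ tomitaGraph M Ω) : (x - u, y - v) ∈ tomitaGraph M Ω := by
  have h2 := tomitaGraph_add h (tomitaGraph_smul (-1) h')
  simpa [sub_eq_add_neg] using h2

/-- Commuting algebras have formally adjoint Tomita operators: on the cores both sides are `⟪Ω, b a
Ω⟫`, and the identity passes to closures. This is the easy half of duality. -/
theorem tomitaGraph_pair {N : VonNeumannAlgebra H} (hc : ∀ a ∈ M, ∀ b ∈ N, a * b = b * a)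
    {x y u v : H} (h : (x, y) ∈ tomitaGraph M Ω) (h' : (u, v) ∈ tomitaGraph N Ω) :
    ⟪v, x⟫_ℂ = ⟪y, u⟫_ℂ := by
  refine tomitaGraph_subset (S := {z | ⟪v, z.1⟫_ℂ = ⟪z.2, u⟫_ℂ})
    (isClosed_eq (by fun_prop) (by fun_prop)) (fun a ha => ?_) h
  refine tomitaGraph_subset (S := {z | ⟪z.2, a Ω⟫_ℂ = ⟪(star a) Ω, z.1⟫_ℂ})
    (isClosed_eq (by fun_prop) (by fun_prop)) (fun b hb => ?_) h'
  change ⟪(star b) Ω, a Ω⟫_ℂ = ⟪(star a) Ω, b Ω⟫_ℂ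
  rw [star_apply_inner, star_apply_inner]
  exact congrArg (fun T : H →L[ℂ] H => ⟪Ω, T Ω⟫_ℂ) (hc a ha b hb).symm

theorem mem_commutant {N : VonNeumannAlgebra H} {z : H →L[ℂ] H} :
    z ∈ N.commutant ↔ ∀ g ∈ N, g * z = z * g := VonNeumannAlgebra.mem_commutant_iff

theorem IsCyclic.exists_dist_lt {N : VonNeumannAlgebra H} (h : IsCyclic N Ω) (x : H) {ε : ℝ}
    (hε : 0 < ε) : ∃ a ∈ N, ‖x - a Ω‖ < ε := by
  obtain ⟨_, hd, ⟨a, ha, rfl⟩⟩ := Metric.dense_iff.1 h x ε hε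
  refine ⟨a, ha, ?_⟩
  rw [Metric.mem_ball, dist_eq_norm, norm_sub_rev] at hd
  exact hd

/-- The closed Tomita operator of `N` is the adjoint of that of the commutant of `N`. -/
theorem mem_tomitaGraph_of_adjoint {N : VonNeumannAlgebra H} (hcyc : IsCyclic N.commutant Ω)
    {x y : H} (h : ∀ c ∈ N.commutant, ⟪(star c) Ω, x⟫_ℂ = ⟪y, c Ω⟫_ℂ) :
    (x, y) ∈ tomitaGraph N Ω := by
  have hxy : ∀ c ∈ N.commutant, ∀ d ∈ N.commutant, ⟪c x, d Ω⟫_ℂ = ⟪c Ω, d y⟫_ℂ := by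
    intro c hc d hd
    have := h (star d * c) (mul_mem (star_mem hd) hc)
    rw [star_mul, star_star] at this
    change ⟪(star c) (d Ω), x⟫_ℂ = ⟪y, (star d) (c Ω)⟫_ℂ at this
    rw [star_apply_inner, inner_star_apply] at this
    rw [← inner_conj_symm, this, inner_conj_symm]
  refine Metric.mem_closure_iff.2 fun ε hε => ?_
  have hε' : 0 < ε / 2 := by positivity
  obtain ⟨d, hd, hdx⟩ := hcyc.exists_dist_lt x hε'
  obtain ⟨c, hc, hcy⟩ := hcyc.exists_dist_lt y hε'
  -- The approximants `d` and `c` are fixed before `t`, so `t` can be taken small against `‖d y‖`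
  -- and `‖c x‖`.
  obtain ⟨t, ht, htd, htc⟩ : ∃ t : ℝ, 0 < t ∧ t * ‖d y‖ < ε / 2 ∧ t * ‖c x‖ < ε / 2 := by
    refine ⟨ε / 2 / (‖d y‖ + ‖c x‖ + 1), by positivity, ?_, ?_⟩
    all_goals
      rw [div_mul_eq_mul_div, div_lt_iff₀ (by positivity)]
      nlinarith [norm_nonneg (d y), norm_nonneg (c x)]
  -- Graph of `cΩ ↦ t c x`, which commutes with `N'`; its adjoint contains `dΩ ↦ t d y` by `hxy`.
  -- The entries `p, q, r, s` of the projection onto its closure are bounded, `q` lies in `N`, and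
  -- `t⁻¹ q` will be the approximating element.
  let S : Submodule ℂ (H × H) :=
    { carrier := {z | ∃ c ∈ N.commutant, z = (c Ω, (t : ℂ) • c x)}
      zero_mem' := ⟨0, zero_mem _, by ext <;> simp⟩
      add_mem' := by
        rintro _ _ ⟨a, ha, rfl⟩ ⟨b, hb, rfl⟩
        exact ⟨a + b, add_mem ha hb, by ext <;> simp⟩
      smul_mem' := by
        rintro r _ ⟨a, ha, rfl⟩
        refine ⟨r • a, N.commutant.toStarSubalgebra.smul_mem ha r, ?_⟩
        ext
        · rfl
        · exact smul_comm _ _ _ }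
  let K := S.topologicalClosure
  have hK : IsClosed (K : Set (H × H)) := S.isClosed_topologicalClosure
  have hSK : ∀ c ∈ N.commutant, (c Ω, (t : ℂ) • c x) ∈ K := fun c hc =>
    S.le_topologicalClosure ⟨c, hc, rfl⟩
  have hKort : ∀ {P Q : H}, (∀ c ∈ N.commutant, ⟪c Ω, P⟫_ℂ + ⟪(t : ℂ) • c x, Q⟫_ℂ = 0) →
      ∀ z ∈ K, ⟪z.1, P⟫_ℂ + ⟪z.2, Q⟫_ℂ = 0 := by
    intro P Q hPQ z hz
    have : (S : Set (H × H)) ⊆ {z : H × H | ⟪z.1, P⟫_ℂ + ⟪z.2, Q⟫_ℂ = 0} := by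
      rintro _ ⟨c, hc, rfl⟩
      exact hPQ c hc
    exact closure_minimal this (isClosed_eq (by fun_prop) (by fun_prop)) hz
  have hKinv : ∀ e ∈ N.commutant, ∀ z ∈ K, (e z.1, e z.2) ∈ K := by
    intro e he z hz
    refine map_mem_closure (f := fun z : H × H => (e z.1, e z.2)) (by fun_prop) hz ?_
    rintro _ ⟨c, hc, rfl⟩
    exact ⟨e * c, mul_mem he hc, by simp⟩
  obtain ⟨p, q, r, s, h1, h2⟩ := exists_block_projection K hK
  have hU : ∀ {h k u v : H}, (u, v) ∈ K → (∀ z ∈ K, ⟪z.1, h - u⟫_ℂ + ⟪z.2, k - v⟫_ℂ = 0) →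
      p h + r k = u ∧ q h + s k = v := fun hm ho => block_projection_unique h1 h2 hm ho
  -- the entries of the projection lie in the algebra
  have hqN : q ∈ N := by
    rw [← N.commutant_commutant, mem_commutant]
    intro e he
    ext k
    change e (q k) = q (e k)
    have := (hU (h := e k) (k := 0) (u := e (p k)) (v := e (q k)) ?_ ?_).2
    · simpa using this.symm
    · have := hKinv e he _ (h1 k 0)
      simpa using this
    · intro z hz
      have := h2 k 0 _ (hKinv (star e) (star_mem he) z hz)
      simp only [map_zero, add_zero, star_apply_inner, map_sub] at this ⊢
      exact this
  have hsa : ∀ h k : H, ⟪r h, k⟫_ℂ = ⟪h, q k⟫_ℂ := by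
    intro h k
    have a := h2 k 0 _ (h1 0 h)
    have b := h2 0 h _ (h1 k 0)
    simp only [map_zero, add_zero, zero_add, zero_sub, inner_sub_right, inner_neg_right] at a b
    have b' := congrArg conj b
    simp only [map_add, map_sub, map_neg, inner_conj_symm, map_zero] at b'
    linear_combination a - b'
  have hr : r = star q := by
    ext h
    refine ext_inner_right ℂ fun k => ?_
    rw [star_apply_inner, hsa]
  have tne : (t : ℂ) ≠ 0 := by exact_mod_cast ht.ne'
  -- `(Ω, t x)` lies in `K` and is fixed by the projection.
  have hq1 : q Ω + s ((t : ℂ) • x) = (t : ℂ) • x := by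
    refine (hU (u := Ω) ?_ ?_).2
    · simpa using hSK 1 (one_mem _)
    · intro z _; simp
  -- `(-t y, Ω)` is orthogonal to `K` and is annihilated. Together with `r = q*` this evaluates `t⁻¹
  -- q` and its adjoint on `Ω` as `x - s x` and `p y`.
  have hq2 : r Ω = (t : ℂ) • p y := by
    have := (hU (h := -((t : ℂ) • y)) (k := Ω) (u := 0) (v := 0) K.zero_mem ?_).1
    · simp only [map_neg, map_smul] at this
      exact (neg_add_eq_zero.1 this).symm
    · refine hKort fun e he => ?_
      have := hxy e he 1 (one_mem _)
      simp only [one_apply_eq_self] at this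
      rw [sub_zero, sub_zero, inner_neg_right, inner_smul_right, inner_smul_left, this]
      simp
  -- norm estimates
  have hpyth : ∀ h k : H, ∀ z ∈ K, ‖h - (p h + r k)‖ ^ 2 + ‖k - (q h + s k)‖ ^ 2 ≤
      ‖h - z.1‖ ^ 2 + ‖k - z.2‖ ^ 2 := by
    intro h k z hz
    have a := h2 h k _ (K.sub_mem (h1 h k) hz)
    simp only [Prod.fst_sub, Prod.snd_sub] at a
    have a' := congrArg Complex.re a
    rw [Complex.add_re, Complex.zero_re] at a'
    have e1 := norm_add_sq (𝕜 := ℂ) (p h + r k - z.1) (h - (p h + r k))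
    have e2 := norm_add_sq (𝕜 := ℂ) (q h + s k - z.2) (k - (q h + s k))
    rw [show p h + r k - z.1 + (h - (p h + r k)) = h - z.1 by abel] at e1
    rw [show q h + s k - z.2 + (k - (q h + s k)) = k - z.2 by abel] at e2
    simp only [RCLike.re_to_complex] at e1 e2
    nlinarith [sq_nonneg ‖p h + r k - z.1‖, sq_nonneg ‖q h + s k - z.2‖]
  have hpyth' : ∀ h k P Q : H, (∀ z ∈ K, ⟪z.1, P⟫_ℂ + ⟪z.2, Q⟫_ℂ = 0) →
      ‖p h + r k‖ ^ 2 + ‖q h + s k‖ ^ 2 ≤ ‖h - P‖ ^ 2 + ‖k - Q‖ ^ 2 := by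
    intro h k P Q ho
    have a := h2 h k _ (h1 h k)
    have b := ho _ (h1 h k)
    have a' := congrArg Complex.re a
    have b' := congrArg Complex.re b
    rw [Complex.add_re, Complex.zero_re] at a' b'
    have e1 := norm_add_sq (𝕜 := ℂ) (p h + r k) (h - (p h + r k) - P)
    have e2 := norm_add_sq (𝕜 := ℂ) (q h + s k) (k - (q h + s k) - Q)
    rw [show p h + r k + (h - (p h + r k) - P) = h - P by abel] at e1
    rw [show q h + s k + (k - (q h + s k) - Q) = k - Q by abel] at e2
    simp only [RCLike.re_to_complex, inner_sub_right _ _ P, inner_sub_right _ _ Q,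
      Complex.sub_re] at e1 e2
    nlinarith [sq_nonneg ‖h - (p h + r k) - P‖, sq_nonneg ‖k - (q h + s k) - Q‖]
  have hs1 : ‖s (x - d Ω)‖ ≤ ‖x - d Ω‖ := by
    have := hpyth' 0 (x - d Ω) 0 0 (by simp)
    simp only [map_zero, zero_add, sub_zero, norm_zero] at this
    nlinarith [sq_nonneg ‖r (x - d Ω)‖, norm_nonneg (x - d Ω), norm_nonneg (s (x - d Ω))]
  -- `(-t d y, dΩ)` is orthogonal to `K`, so `(0, dΩ)` is within `t ‖d y‖` of a vector with zero
  -- projection.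
  have hs2 : ‖s (d Ω)‖ ≤ t * ‖d y‖ := by
    have := hpyth' 0 (d Ω) (-((t : ℂ) • d y)) (d Ω) (hKort fun e he => by
      rw [inner_neg_right, inner_smul_right, inner_smul_left, hxy e he d hd]; simp)
    simp only [map_zero, zero_add, sub_self, norm_zero, zero_sub, neg_neg, norm_smul,
      Complex.norm_real, Real.norm_eq_abs, abs_of_pos ht] at this
    have h0 : 0 ≤ t * ‖d y‖ := by positivity
    nlinarith [sq_nonneg ‖r (d Ω)‖, norm_nonneg (s (d Ω))]
  have hp1 : ‖(y - c Ω) - p (y - c Ω)‖ ≤ ‖y - c Ω‖ := by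
    have := hpyth (y - c Ω) 0 0 K.zero_mem
    simp only [map_zero, add_zero, Prod.fst_zero, Prod.snd_zero, sub_zero, norm_zero] at this
    nlinarith [sq_nonneg ‖0 - q (y - c Ω)‖, norm_nonneg (y - c Ω),
      norm_nonneg ((y - c Ω) - p (y - c Ω))]
  -- `(cΩ, t c x)` lies in `K` at distance `t ‖c x‖` from `(cΩ, 0)`, and the projection minimises
  -- the distance.
  have hp2 : ‖c Ω - p (c Ω)‖ ≤ t * ‖c x‖ := by
    have := hpyth (c Ω) 0 _ (hSK c hc)
    simp only [map_zero, add_zero, sub_self, norm_zero, zero_sub, norm_neg, norm_smul,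
      Complex.norm_real, Real.norm_eq_abs, abs_of_pos ht] at this
    have h0 : 0 ≤ t * ‖c x‖ := by positivity
    nlinarith [sq_nonneg ‖q (c Ω)‖, norm_nonneg (c Ω - p (c Ω))]
  have hsx : ‖s x‖ < ε := by
    have : s x = s (x - d Ω) + s (d Ω) := by rw [← map_add]; simp
    rw [this]
    exact (norm_add_le _ _).trans_lt (by linarith)
  have hpy : ‖y - p y‖ < ε := by
    have : y - p y = ((y - c Ω) - p (y - c Ω)) + (c Ω - p (c Ω)) := by rw [map_sub]; abel
    rw [this]
    exact (norm_add_le _ _).trans_lt (by linarith)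
  refine ⟨_, ⟨(t : ℂ)⁻¹ • q, N.toStarSubalgebra.smul_mem hqN _, rfl⟩, ?_⟩
  have e1 : ((t : ℂ)⁻¹ • q) Ω = x - s x := by
    rw [smul_apply, eq_sub_of_add_eq hq1, map_smul, ← smul_sub,
      inv_smul_smul₀ tne]
  have e2 : (star ((t : ℂ)⁻¹ • q)) Ω = p y := by
    rw [star_smul, ← hr, smul_apply, hq2]
    simp only [star_inv₀, Complex.star_def, Complex.conj_ofReal]
    rw [inv_smul_smul₀ tne]
  rw [e1, e2, Prod.dist_eq, dist_eq_norm, dist_eq_norm, sub_sub_cancel]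
  exact max_lt hsx hpy

/-- `tomitaGraph M Ω = {(x, J y) | (x, y) ∈ G}` with `G` a positive self-adjoint operator. -/
structure IsModularRel (M : VonNeumannAlgebra H) (Ω : H) (J : H ≃ₗᵢ⋆[ℂ] H) (G : Set (H × H)) :
    Prop where
  isPosRel : IsPosRel G
  mem_iff : ∀ x y, (x, y) ∈ tomitaGraph M Ω ↔ (x, J.symm y) ∈ G
  single_valued : ∀ y, ((0 : H), y) ∈ G → y = 0
  dense_dom : Dense {x | ∃ y, (x, y) ∈ G}

theorem IsModularConjugation.exists_rel {J : H ≃ₗᵢ⋆[ℂ] H} (h : IsModularConjugation M Ω J) :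
    ∃ G, IsModularRel M Ω J G := by
  obtain ⟨P, hP, hpos, hgr⟩ := h
  refine ⟨_, isPosRel_graph hP hpos, ?_, ?_, ?_⟩
  · intro x y
    rw [hgr]
    refine exists_congr fun hx => ?_
    rw [← LinearIsometryEquiv.symm_apply_eq]
  · rintro y ⟨hx, hy⟩
    exact hy.trans (P.map_zero)
  · exact hP.dense_domain.mono fun x hx => ⟨P ⟨x, hx⟩, hx, rfl⟩

theorem IsModularRel.isModularConjugation {J : H ≃ₗᵢ⋆[ℂ] H} {G : Set (H × H)}
    (h : IsModularRel M Ω J G) : IsModularConjugation M Ω J := by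
  obtain ⟨P, hP, hpos, hgr⟩ := h.isPosRel.exists_linearPMap h.single_valued h.dense_dom
  refine ⟨P, hP, hpos, fun x y => ?_⟩
  rw [h.mem_iff, hgr]
  refine exists_congr fun hx => ?_
  rw [LinearIsometryEquiv.symm_apply_eq]

namespace IsModularRel

variable {J : H ≃ₗᵢ⋆[ℂ] H} {G : Set (H × H)}

theorem swap_mem (h : IsModularRel M Ω J G) {x y : H} (hxy : (x, y) ∈ G) :
    (J y, J.symm x) ∈ G :=
  (h.mem_iff _ _).1 (tomitaGraph_swap ((h.mem_iff _ _).2 (by simpa using hxy)))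

theorem dense_range (h : IsModularRel M Ω J G) : Dense {y | ∃ x, (x, y) ∈ G} := by
  have := h.dense_dom.preimage J.toHomeomorph.isOpenMap
  refine this.mono ?_
  rintro y ⟨w, hw⟩
  have := h.swap_mem hw
  exact ⟨J w, by simpa using this⟩

/-- The Tomita operator is its own inverse, so `J P` and `J⁻¹ (J P⁻¹ J⁻¹)` are polar decompositions
of the same operator. -/
theorem symm_eq (h : IsModularRel M Ω J G) : J = J.symm := by
  refine h.isPosRel.conj_unique (h.isPosRel.swap_conj J.symm) h.single_valued h.dense_range _ _ ?_
  intro x y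
  change _ ↔ (J.symm (J.symm.symm y), J.symm x) ∈ G
  rw [← h.mem_iff, LinearIsometryEquiv.symm_symm, LinearIsometryEquiv.symm_apply_apply,
    ← h.mem_iff]
  exact ⟨tomitaGraph_swap, tomitaGraph_swap⟩

theorem apply_apply (h : IsModularRel M Ω J G) (x : H) : J (J x) = x := by
  have := congrArg (fun K : H ≃ₗᵢ⋆[ℂ] H => K (J x)) h.symm_eq
  simpa using this

theorem mem_tomitaGraph_iff (h : IsModularRel M Ω J G) (x y : H) :
    (x, y) ∈ tomitaGraph M Ω ↔ (x, J y) ∈ G := by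
  rw [h.mem_iff, ← h.symm_eq]

theorem conj_swap_mem (h : IsModularRel M Ω J G) {x y : H} (hxy : (x, y) ∈ G) :
    (J y, J x) ∈ G := by
  have := h.swap_mem hxy
  rwa [← h.symm_eq] at this

/-- A unitary involution that commutes with the Tomita operator commutes with `J`. -/
theorem commute_of_preserves (h : IsModularRel M Ω J G) (U : H ≃ₗᵢ[ℂ] H) (hU : ∀ x, U (U x) = x)
    (hT : ∀ x y, (x, y) ∈ tomitaGraph M Ω → (U x, U y) ∈ tomitaGraph M Ω) (x : H) :
    J (U x) = U (J x) := by
  have hUs : U.symm = U := by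
    ext x
    rw [LinearIsometryEquiv.symm_apply_eq, hU]
  -- Conjugating `S = J P` by `U` gives a second polar decomposition of `S`, with antiunitary part
  -- `U J U`.
  have : J = (U.trans J).trans U := by
    refine h.isPosRel.conj_unique (h.isPosRel.comap U) h.single_valued h.dense_range _ _ ?_
    intro x y
    change _ ↔ (U x, U (U.symm (J.symm (U.symm y)))) ∈ G
    rw [U.apply_symm_apply, hUs, ← h.mem_iff, ← h.mem_iff]
    refine ⟨hT x y, fun h' => ?_⟩
    have := hT _ _ h'
    rwa [hU, hU] at this
  have h2 := congrArg (fun K : H ≃ₗᵢ⋆[ℂ] H => K (U x)) this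
  simp only [LinearIsometryEquiv.trans_apply, hU] at h2
  exact h2

/-- `S Ω = Ω` puts `(Ω, J Ω)` in `G`. The identity `⟪a* Ω, Ω⟫ = ⟪Ω, a Ω⟫` says that `Ω` is also
fixed by the adjoint of `S`, which puts `(J Ω, Ω)` in `G`; positivity identifies the two vectors. -/
theorem apply_vector (h : IsModularRel M Ω J G) : J Ω = Ω := by
  have h1 : (Ω, J Ω) ∈ G := (h.mem_tomitaGraph_iff _ _).1
    (by simpa using mem_tomitaGraph (Ω := Ω) (one_mem M))
  have h2 : (J Ω, Ω) ∈ G := by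
    rw [h.isPosRel.mem_iff]
    rintro ⟨u, v⟩ huv
    have huv' : (u, J v) ∈ tomitaGraph M Ω := by
      rw [h.mem_tomitaGraph_iff, h.apply_apply]; exact huv
    have := tomitaGraph_subset (S := {z : H × H | ⟪z.2, Ω⟫_ℂ = ⟪Ω, z.1⟫_ℂ})
      (isClosed_eq (by fun_prop) (by fun_prop)) (fun a _ => star_apply_inner a Ω Ω) huv'
    simp only
    rw [antiunitary_inner_left, ← h.symm_eq]
    exact this
  exact (h.isPosRel.eq_of_swap_mem h1 h2).symm

/-- The domain of the closed Tomita operator is dense and contained in the closure of `M Ω`, so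
cyclicity is built into the existence of a modular conjugation. -/
theorem dense_orbit (h : IsModularRel M Ω J G) : IsCyclic M Ω := by
  refine (h.dense_dom.mono ?_).of_closure
  rintro x ⟨y, hxy⟩
  have : (x, J y) ∈ tomitaGraph M Ω := by
    rw [h.mem_tomitaGraph_iff, h.apply_apply]; exact hxy
  exact tomitaGraph_subset (S := {z : H × H | z.1 ∈ closure {x | ∃ a ∈ M, x = a Ω}})
    (isClosed_closure.preimage continuous_fst) (fun a ha => subset_closure ⟨a, ha, rfl⟩) this

end IsModularRel

/-- A cyclic vector for `M` is separating for every algebra that commutes with `M`. -/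
theorem IsCyclic.isSeparating {N : VonNeumannAlgebra H} (h : IsCyclic M Ω)
    (hc : ∀ a ∈ M, ∀ b ∈ N, a * b = b * a) : IsSeparating N Ω := by
  intro b hb h0
  have := Continuous.ext_on h (f := b) (g := 0) b.continuous continuous_zero ?_
  · ext x; exact congrFun this x
  · rintro _ ⟨a, ha, rfl⟩
    have := congrArg (fun T : H →L[ℂ] H => T Ω) (hc a ha b hb)
    change a (b Ω) = b (a Ω) at this
    rw [← this, h0, map_zero]
    rfl

end Tomita

/-! ### Generated algebras and their commutants -/

section Generated

variable {H : Type u} [NormedAddCommGroup H] [InnerProductSpace ℂ H] [CompleteSpace H]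

theorem mem_commutant_generated {S : Set (H →L[ℂ] H)} {T : H →L[ℂ] H} :
    T ∈ (generated S).commutant ↔ ∀ s ∈ S, s * T = T * s ∧ star s * T = T * star s := by
  rw [generated, VonNeumannAlgebra.commutant_commutant]
  change T ∈ Set.centralizer (S ∪ star S) ↔ _
  rw [Set.mem_centralizer_iff]
  constructor
  · intro h s hs
    exact ⟨h s (Or.inl hs), h _ (Or.inr (by simpa using hs))⟩
  · rintro h s (hs | hs)
    · exact (h s hs).1
    · simpa using (h _ hs).2

theorem mem_generated {S : Set (H →L[ℂ] H)} {T : H →L[ℂ] H} :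
    T ∈ generated S ↔ ∀ g, (∀ s ∈ S, s * g = g * s ∧ star s * g = g * star s) → g * T = T * g := by
  rw [← (generated S).commutant_commutant, mem_commutant]
  exact forall_congr' fun g => by rw [mem_commutant_generated]

theorem subset_generated {S : Set (H →L[ℂ] H)} {T : H →L[ℂ] H} (h : T ∈ S) : T ∈ generated S :=
  mem_generated.2 fun _ hg => (hg T h).1.symm

theorem mem_commutant_join {A B : VonNeumannAlgebra H} {T : H →L[ℂ] H} :
    T ∈ (join A B).commutant ↔ T ∈ A.commutant ∧ T ∈ B.commutant := by
  rw [join, mem_commutant_generated, mem_commutant, mem_commutant]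
  constructor
  · exact fun h => ⟨fun g hg => (h g (Or.inl hg)).1, fun g hg => (h g (Or.inr hg)).1⟩
  · rintro ⟨h1, h2⟩ s (hs | hs)
    · exact ⟨h1 s hs, h1 _ (star_mem (s := A) hs)⟩
    · exact ⟨h2 s hs, h2 _ (star_mem (s := B) hs)⟩

theorem left_mem_join {A B : VonNeumannAlgebra H} {T : H →L[ℂ] H} (h : T ∈ A) : T ∈ join A B :=
  subset_generated (Or.inl h)

theorem right_mem_join {A B : VonNeumannAlgebra H} {T : H →L[ℂ] H} (h : T ∈ B) : T ∈ join A B :=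
  subset_generated (Or.inr h)

end Generated

/-! ### Hilbert tensor products given by a bilinear map -/

section AbstractTensor

variable {H₁ H₂ H : Type u} [NormedAddCommGroup H₁] [InnerProductSpace ℂ H₁]
  [NormedAddCommGroup H₂] [InnerProductSpace ℂ H₂]
  [NormedAddCommGroup H] [InnerProductSpace ℂ H]

/-- `H` is the Hilbert space tensor product of `H₁` and `H₂` with elementary tensors `m h k`. -/
structure IsHilbertTensor (m : H₁ →ₗ[ℂ] H₂ →ₗ[ℂ] H) : Prop where
  inner_eq : ∀ h k h' k', ⟪m h k, m h' k'⟫_ℂ = ⟪h, h'⟫_ℂ * ⟪k, k'⟫_ℂ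
  dense : Dense (Submodule.span ℂ {x | ∃ h k, m h k = x} : Set H)

theorem inner_self_eq_ofReal (x : H) : ⟪x, x⟫_ℂ = ((‖x‖ ^ 2 : ℝ) : ℂ) := by
  rw [inner_self_eq_norm_sq_to_K]
  simp

namespace IsHilbertTensor

variable {m : H₁ →ₗ[ℂ] H₂ →ₗ[ℂ] H}

theorem flip (hm : IsHilbertTensor m) : IsHilbertTensor m.flip where
  inner_eq h k h' k' := by
    rw [LinearMap.flip_apply, LinearMap.flip_apply, hm.inner_eq, mul_comm]
  dense := by
    have : {x | ∃ h k, m.flip h k = x} = {x | ∃ h k, m h k = x} := by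
      ext x
      exact exists_comm
    rw [this]
    exact hm.dense

theorem ext_clm (hm : IsHilbertTensor m) {K : Type*} [NormedAddCommGroup K] [NormedSpace ℂ K]
    {σ : ℂ →+* ℂ} {S T : H →SL[σ] K} (h : ∀ x y, S (m x y) = T (m x y)) : S = T :=
  ContinuousLinearMap.ext_on hm.dense (by rintro _ ⟨x, y, rfl⟩; exact h x y)

theorem ext_inner (hm : IsHilbertTensor m) {z w : H}
    (h : ∀ x y, ⟪m x y, z⟫_ℂ = ⟪m x y, w⟫_ℂ) : z = w := by
  have h0 : innerSL ℂ z = innerSL ℂ w := hm.ext_clm fun x y => by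
    rw [innerSL_apply_apply, innerSL_apply_apply, ← inner_conj_symm, h, inner_conj_symm]
  refine ext_inner_right ℂ fun v => ?_
  have := congrArg (fun T : H →L[ℂ] ℂ => T v) h0
  simpa using this

theorem norm_apply (hm : IsHilbertTensor m) (h : H₁) (k : H₂) : ‖m h k‖ = ‖h‖ * ‖k‖ := by
  have h1 := hm.inner_eq h k h k
  rw [inner_self_eq_ofReal, inner_self_eq_ofReal, inner_self_eq_ofReal] at h1
  have h2 : ‖m h k‖ ^ 2 = (‖h‖ * ‖k‖) ^ 2 := by
    rw [mul_pow]
    exact_mod_cast h1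
  exact (pow_left_inj₀ (norm_nonneg _) (by positivity) two_ne_zero).1 h2

theorem inner_lift (hm : IsHilbertTensor m) (t s : H₁ ⊗[ℂ] H₂) :
    ⟪TensorProduct.lift m t, TensorProduct.lift m s⟫_ℂ = ⟪t, s⟫_ℂ := by
  induction t with
  | zero => simp
  | add a b ha hb => rw [map_add, inner_add_left, inner_add_left, ha, hb]
  | tmul h k =>
    induction s with
    | zero => simp
    | add a b ha hb => rw [map_add, inner_add_right, inner_add_right, ha, hb]
    | tmul h' k' => simp [hm.inner_eq]

theorem norm_lift (hm : IsHilbertTensor m) (t : H₁ ⊗[ℂ] H₂) : ‖TensorProduct.lift m t‖ = ‖t‖ := by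
  rw [@norm_eq_sqrt_re_inner ℂ, @norm_eq_sqrt_re_inner ℂ, hm.inner_lift]

theorem denseRange_lift (hm : IsHilbertTensor m) : DenseRange (TensorProduct.lift m) := by
  have : (Submodule.span ℂ {x | ∃ h k, m h k = x} : Set H)
      ⊆ (LinearMap.range (TensorProduct.lift m) : Set H) := by
    refine Submodule.span_le.2 ?_
    rintro _ ⟨h, k, rfl⟩
    exact ⟨h ⊗ₜ k, by simp⟩
  exact hm.dense.mono this

theorem exists_extension (hm : IsHilbertTensor m) {K : Type*} [NormedAddCommGroup K]
    [NormedSpace ℂ K] [CompleteSpace K] {σ : ℂ →+* ℂ} [RingHomIsometric σ]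
    (f : H₁ →ₛₗ[σ] H₂ →ₛₗ[σ] K) (C : ℝ) (hC : ∀ t, ‖TensorProduct.lift f t‖ ≤ C * ‖t‖) :
    ∃ F : H →SL[σ] K, ∀ h k, F (m h k) = f h k := by
  refine ⟨(TensorProduct.lift f).extendOfNorm (TensorProduct.lift m), fun h k => ?_⟩
  have := LinearMap.extendOfNorm_eq (f := TensorProduct.lift f) (e := TensorProduct.lift m)
    hm.denseRange_lift ⟨C, fun t => by rw [hm.norm_lift]; exact hC t⟩ (h ⊗ₜ k)
  simpa using this

/-- Elementary tensors with the same Gram matrix, up to conjugation, are related by a unitary or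
antiunitary map. -/
theorem exists_isometryEquiv (hm : IsHilbertTensor m) [CompleteSpace H]
    {K : Type u} [NormedAddCommGroup K]
    [InnerProductSpace ℂ K] [CompleteSpace K] {σ σ' : ℂ →+* ℂ} [RingHomInvPair σ σ']
    [RingHomInvPair σ' σ] [RingHomIsometric σ] (f : H₁ →ₛₗ[σ] H₂ →ₛₗ[σ] K)
    (hf : ∀ h k h' k', ⟪f h k, f h' k'⟫_ℂ = σ (⟪h, h'⟫_ℂ * ⟪k, k'⟫_ℂ))
    (hd : Dense (Submodule.span ℂ {x | ∃ h k, f h k = x} : Set K)) :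
    ∃ F : H ≃ₛₗᵢ[σ] K, ∀ h k, F (m h k) = f h k := by
  have hin : ∀ t s, ⟪TensorProduct.lift f t, TensorProduct.lift f s⟫_ℂ = σ ⟪t, s⟫_ℂ := by
    intro t s
    induction t with
    | zero => simp
    | add a b ha hb => rw [map_add, inner_add_left, inner_add_left, ha, hb, map_add]
    | tmul h k =>
      induction s with
      | zero => simp
      | add a b ha hb => rw [map_add, inner_add_right, inner_add_right, ha, hb, map_add]
      | tmul h' k' => simp [hf]
  have hno : ∀ t, ‖TensorProduct.lift f t‖ = ‖t‖ := by
    intro t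
    have h1 : ‖⟪TensorProduct.lift f t, TensorProduct.lift f t⟫_ℂ‖ = ‖⟪t, t⟫_ℂ‖ := by
      rw [hin, RingHomIsometric.norm_map]
    have h2 : ⟪t, t⟫_ℂ = ((‖t‖ ^ 2 : ℝ) : ℂ) := inner_self_eq_ofReal t
    rw [inner_self_eq_ofReal, h2] at h1
    simp only [norm_pow, Complex.norm_real, Real.norm_eq_abs, abs_norm] at h1
    exact (pow_left_inj₀ (norm_nonneg _) (norm_nonneg _) two_ne_zero).1 h1
  obtain ⟨F, hF⟩ := hm.exists_extension f 1 (fun t => by rw [hno, one_mul])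
  have hFt : ∀ t, F (TensorProduct.lift m t) = TensorProduct.lift f t := by
    intro t
    induction t with
    | zero => simp
    | add a b ha hb => rw [map_add, map_add, map_add, ha, hb]
    | tmul h k => simp [hF]
  have hFn : ∀ x, ‖F x‖ = ‖x‖ := by
    intro x
    refine hm.denseRange_lift.induction_on x (isClosed_eq (by fun_prop) (by fun_prop)) fun t => ?_
    rw [hFt, hno, hm.norm_lift]
  let F' : H →ₛₗᵢ[σ] K := ⟨F.toLinearMap, hFn⟩
  have hsurj : Function.Surjective F' := by
    have hcl : IsClosed (Set.range F') := F'.isometry.isClosedEmbedding.isClosed_range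
    have hdr : Dense (Set.range F') := by
      have : (Submodule.span ℂ {x | ∃ h k, f h k = x} : Set K)
          ⊆ (LinearMap.range F'.toLinearMap : Set K) := by
        refine Submodule.span_le.2 ?_
        rintro _ ⟨h, k, rfl⟩
        exact ⟨m h k, hF h k⟩
      exact hd.mono this
    intro y
    have : y ∈ closure (Set.range F') := hdr y
    rwa [hcl.closure_eq] at this
  exact ⟨LinearIsometryEquiv.ofSurjective F' hsurj, hF⟩

/-- The tensor product of two antiunitary operators. -/
theorem exists_conj (hm : IsHilbertTensor m) [CompleteSpace H] (J₁ : H₁ ≃ₗᵢ⋆[ℂ] H₁)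
    (J₂ : H₂ ≃ₗᵢ⋆[ℂ] H₂) [CompleteSpace H₁] [CompleteSpace H₂] :
    ∃ J : H ≃ₗᵢ⋆[ℂ] H, ∀ h k, J (m h k) = m (J₁ h) (J₂ k) := by
  let f : H₁ →ₗ⋆[ℂ] H₂ →ₗ⋆[ℂ] H := LinearMap.mk₂'ₛₗ _ _ (fun h k => m (J₁ h) (J₂ k))
    (fun x y z => by simp) (fun c x y => by rw [J₁.map_smulₛₗ, map_smul, LinearMap.smul_apply])
    (fun x y z => by simp) (fun c x y => by rw [J₂.map_smulₛₗ, map_smul])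
  refine hm.exists_isometryEquiv f (fun h k h' k' => ?_) ?_
  · change ⟪m (J₁ h) (J₂ k), m (J₁ h') (J₂ k')⟫_ℂ = _
    rw [hm.inner_eq, antiunitary_inner, antiunitary_inner, map_mul, inner_conj_symm,
      inner_conj_symm]
  · have : {x | ∃ h k, f h k = x} = {x | ∃ h k, m h k = x} := by
      ext x
      constructor
      · rintro ⟨h, k, rfl⟩
        exact ⟨J₁ h, J₂ k, rfl⟩
      · rintro ⟨h, k, rfl⟩
        exact ⟨J₁.symm h, J₂.symm k, by simp [f]⟩
    rw [this]
    exact hm.dense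

/-- The identification with the completed algebraic tensor product. -/
theorem exists_unitary (hm : IsHilbertTensor m) [CompleteSpace H] :
    ∃ W : HilbertTensor H₁ H₂ ≃ₗᵢ[ℂ] H, ∀ h k, W (tmul h k) = m h k := by
  let m₀ : H₁ →ₗ[ℂ] H₂ →ₗ[ℂ] HilbertTensor H₁ H₂ :=
    (TensorProduct.mk ℂ H₁ H₂).compr₂
      (UniformSpace.Completion.toComplL (𝕜 := ℂ) (E := H₁ ⊗[ℂ] H₂)).toLinearMap
  have h₀ : IsHilbertTensor m₀ := by
    constructor
    · intro h k h' k'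
      change ⟪((h ⊗ₜ[ℂ] k : H₁ ⊗[ℂ] H₂) : UniformSpace.Completion (H₁ ⊗[ℂ] H₂)),
        ((h' ⊗ₜ[ℂ] k' : H₁ ⊗[ℂ] H₂) : UniformSpace.Completion (H₁ ⊗[ℂ] H₂))⟫_ℂ = _
      rw [UniformSpace.Completion.inner_coe, TensorProduct.inner_tmul]
    · have hd := UniformSpace.Completion.denseRange_coe (α := H₁ ⊗[ℂ] H₂)
      refine Dense.mono ?_ hd
      rintro _ ⟨t, rfl⟩
      induction t with
      | zero => exact Submodule.zero_mem _
      | add a b ha hb => rw [UniformSpace.Completion.coe_add]; exact Submodule.add_mem _ ha hb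
      | tmul h k => exact Submodule.subset_span ⟨h, k, rfl⟩
  exact h₀.exists_isometryEquiv m (fun h k h' k' => hm.inner_eq h k h' k') hm.dense

/-! ### Amplifications, slices and reductions -/

section Amplification

variable [CompleteSpace H₁] [CompleteSpace H₂] [CompleteSpace H]

/-- Boundedness of `a ⊗ 1` on algebraic tensors: writing `‖a‖² - a* a = d* d` gives `‖(a ⊗ 1) t‖² +
‖(d ⊗ 1) t‖² = ‖a‖² ‖t‖²`. -/
theorem exists_ampl (hm : IsHilbertTensor m) (a : H₁ →L[ℂ] H₁) :
    ∃ T : H →L[ℂ] H, ∀ h k, T (m h k) = m (a h) k := by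
  have hin : ∀ (a b : H₁ →L[ℂ] H₁) (t s : H₁ ⊗[ℂ] H₂),
      ⟪TensorProduct.lift (m ∘ₗ a.toLinearMap) t, TensorProduct.lift (m ∘ₗ b.toLinearMap) s⟫_ℂ
        = ⟪TensorProduct.lift m t, TensorProduct.lift (m ∘ₗ (star a * b).toLinearMap) s⟫_ℂ := by
    intro a b t s
    induction t with
    | zero => simp
    | add a b ha hb => rw [map_add, map_add, inner_add_left, inner_add_left, ha, hb]
    | tmul h k =>
      induction s with
      | zero => simp
      | add a b ha hb => rw [map_add, map_add, inner_add_right, inner_add_right, ha, hb]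
      | tmul h' k' =>
        simp only [TensorProduct.lift.tmul, LinearMap.comp_apply, ContinuousLinearMap.coe_coe,
          hm.inner_eq]
        change _ = ⟪h, (star a) (b h')⟫_ℂ * _
        rw [inner_star_apply]
  obtain ⟨d, hd⟩ := CStarAlgebra.nonneg_iff_eq_star_mul_self.1
    (sub_nonneg.2 (CStarAlgebra.star_mul_le_algebraMap_norm_sq (a := a)))
  refine hm.exists_extension (m ∘ₗ a.toLinearMap) ‖a‖ fun t => ?_
  have e3 : TensorProduct.lift (m ∘ₗ ((algebraMap ℝ (H₁ →L[ℂ] H₁)) (‖a‖ ^ 2)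
      - star a * a).toLinearMap) = ((‖a‖ ^ 2 : ℝ) : ℂ) • TensorProduct.lift m
        - TensorProduct.lift (m ∘ₗ (star a * a).toLinearMap) := by
    refine TensorProduct.ext' fun h k => ?_
    have : (algebraMap ℝ (H₁ →L[ℂ] H₁)) (‖a‖ ^ 2) h = ((‖a‖ ^ 2 : ℝ) : ℂ) • h := by
      rw [Algebra.algebraMap_eq_smul_one]
      exact (Complex.coe_smul _ _).symm
    change m (((algebraMap ℝ (H₁ →L[ℂ] H₁)) (‖a‖ ^ 2) - star a * a) h) k
      = ((‖a‖ ^ 2 : ℝ) : ℂ) • m h k - m ((star a * a) h) k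
    rw [sub_apply, this, map_sub, map_smul, LinearMap.sub_apply, LinearMap.smul_apply]
  have e1 := hin a a t t
  have e2 := hin d d t t
  rw [← hd, e3, LinearMap.sub_apply, LinearMap.smul_apply, inner_sub_right, ← e1,
    inner_smul_right, inner_self_eq_ofReal, inner_self_eq_ofReal, inner_self_eq_ofReal,
    hm.norm_lift] at e2
  have e4 : ‖TensorProduct.lift (m ∘ₗ d.toLinearMap) t‖ ^ 2
      = ‖a‖ ^ 2 * ‖t‖ ^ 2 - ‖TensorProduct.lift (m ∘ₗ a.toLinearMap) t‖ ^ 2 := by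
    exact_mod_cast e2
  refine (pow_le_pow_iff_left₀ (norm_nonneg _) (by positivity) two_ne_zero).1 ?_
  rw [mul_pow]
  nlinarith [sq_nonneg ‖TensorProduct.lift (m ∘ₗ d.toLinearMap) t‖]

/-- The operator `a ⊗ 1`. -/
noncomputable def ampl (hm : IsHilbertTensor m) (a : H₁ →L[ℂ] H₁) : H →L[ℂ] H :=
  (hm.exists_ampl a).choose

@[simp]
theorem ampl_apply (hm : IsHilbertTensor m) (a : H₁ →L[ℂ] H₁) (h : H₁) (k : H₂) :
    hm.ampl a (m h k) = m (a h) k := (hm.exists_ampl a).choose_spec h k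

theorem flip_ampl_apply (hm : IsHilbertTensor m) (b : H₂ →L[ℂ] H₂) (h : H₁) (k : H₂) :
    hm.flip.ampl b (m h k) = m h (b k) := hm.flip.ampl_apply b k h

theorem eq_ampl (hm : IsHilbertTensor m) {T : H →L[ℂ] H} {a : H₁ →L[ℂ] H₁}
    (h : ∀ x y, T (m x y) = m (a x) y) : T = hm.ampl a :=
  hm.ext_clm fun x y => by rw [h, hm.ampl_apply]

theorem ampl_mul (hm : IsHilbertTensor m) (a b : H₁ →L[ℂ] H₁) :
    hm.ampl (a * b) = hm.ampl a * hm.ampl b :=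
  (hm.eq_ampl fun x y => by
    change hm.ampl a (hm.ampl b (m x y)) = m (a (b x)) y
    rw [hm.ampl_apply, hm.ampl_apply]).symm

theorem ampl_add (hm : IsHilbertTensor m) (a b : H₁ →L[ℂ] H₁) :
    hm.ampl (a + b) = hm.ampl a + hm.ampl b :=
  (hm.eq_ampl fun x y => by simp).symm

theorem ampl_smul (hm : IsHilbertTensor m) (c : ℂ) (a : H₁ →L[ℂ] H₁) :
    hm.ampl (c • a) = c • hm.ampl a :=
  (hm.eq_ampl fun x y => by simp).symm

theorem ampl_star (hm : IsHilbertTensor m) (a : H₁ →L[ℂ] H₁) :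
    hm.ampl (star a) = star (hm.ampl a) := by
  refine hm.ext_clm fun x y => hm.ext_inner fun u v => ?_
  rw [hm.ampl_apply, inner_star_apply, hm.ampl_apply, hm.inner_eq, hm.inner_eq, inner_star_apply]

theorem ampl_commute (hm : IsHilbertTensor m) (a : H₁ →L[ℂ] H₁) (b : H₂ →L[ℂ] H₂) :
    hm.ampl a * hm.flip.ampl b = hm.flip.ampl b * hm.ampl a :=
  hm.ext_clm fun x y => by
    change hm.ampl a (hm.flip.ampl b (m x y)) = hm.flip.ampl b (hm.ampl a (m x y))
    simp only [hm.ampl_apply, hm.flip_ampl_apply]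

/-- The map `h ↦ m h k`. -/
noncomputable def left (hm : IsHilbertTensor m) (k : H₂) : H₁ →L[ℂ] H :=
  (m.flip k).mkContinuous ‖k‖ fun h => by rw [LinearMap.flip_apply, hm.norm_apply, mul_comm]

@[simp]
theorem left_apply (hm : IsHilbertTensor m) (k : H₂) (h : H₁) : hm.left k h = m h k := rfl

theorem continuous_left (hm : IsHilbertTensor m) (k : H₂) : Continuous fun h => m h k :=
  (hm.left k).continuous

theorem continuous_right (hm : IsHilbertTensor m) (h : H₁) : Continuous fun k => m h k :=
  hm.flip.continuous_left h

/-- The slice of `T` along the vectors `k`, `k'`. -/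
noncomputable def slice (hm : IsHilbertTensor m) (k k' : H₂) (T : H →L[ℂ] H) : H₁ →L[ℂ] H₁ :=
  (ContinuousLinearMap.adjoint (hm.left k)).comp (T.comp (hm.left k'))

theorem inner_slice (hm : IsHilbertTensor m) (k k' : H₂) (T : H →L[ℂ] H) (h h' : H₁) :
    ⟪h, hm.slice k k' T h'⟫_ℂ = ⟪m h k, T (m h' k')⟫_ℂ := by
  simp [slice, ContinuousLinearMap.adjoint_inner_right]

theorem star_slice (hm : IsHilbertTensor m) (k k' : H₂) (T : H →L[ℂ] H) :
    star (hm.slice k k' T) = hm.slice k' k (star T) := by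
  ext h'
  refine ext_inner_left ℂ fun h => ?_
  rw [inner_star_apply, ← inner_conj_symm, hm.inner_slice, hm.inner_slice, inner_conj_symm,
    inner_star_apply]

/-- Slicing is a bimodule map over the operators `a ⊗ 1`, and the slices determine `T`. Commutation
on `H` thus becomes commutation on the first factor. -/
theorem ampl_commute_iff (hm : IsHilbertTensor m) {a : H₁ →L[ℂ] H₁} {T : H →L[ℂ] H} :
    hm.ampl a * T = T * hm.ampl a ↔
      ∀ k k', a * hm.slice k k' T = hm.slice k k' T * a := by
  have e1 : ∀ h k h' k', ⟪m h k, (hm.ampl a * T) (m h' k')⟫_ℂ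
      = ⟪h, (a * hm.slice k k' T) h'⟫_ℂ := by
    intro h k h' k'
    change ⟪m h k, hm.ampl a (T (m h' k'))⟫_ℂ = ⟪h, a (hm.slice k k' T h')⟫_ℂ
    rw [← star_apply_inner, ← hm.ampl_star, hm.ampl_apply, ← hm.inner_slice, star_apply_inner]
  have e2 : ∀ h k h' k', ⟪m h k, (T * hm.ampl a) (m h' k')⟫_ℂ
      = ⟪h, (hm.slice k k' T * a) h'⟫_ℂ := by
    intro h k h' k'
    change ⟪m h k, T (hm.ampl a (m h' k'))⟫_ℂ = ⟪h, hm.slice k k' T (a h')⟫_ℂ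
    rw [hm.ampl_apply, ← hm.inner_slice]
  constructor
  · intro h k k'
    ext h'
    refine ext_inner_left ℂ fun x => ?_
    rw [← e1, ← e2, h]
  · intro h
    refine hm.ext_clm fun h' k' => hm.ext_inner fun x k => ?_
    rw [e1, e2, h]

theorem ampl_injective (hm : IsHilbertTensor m) {k : H₂} (hk : k ≠ 0) :
    Function.Injective hm.ampl := by
  intro a b hab
  ext h
  have h1 : m (a h) k = m (b h) k := by rw [← hm.ampl_apply, hab, hm.ampl_apply]
  have h2 : ‖m (a h - b h) k‖ = 0 := by
    rw [map_sub, LinearMap.sub_apply, h1, sub_self, norm_zero]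
  rw [hm.norm_apply, mul_eq_zero, norm_eq_zero, norm_eq_zero] at h2
  exact sub_eq_zero.1 (h2.resolve_right hk)

/-- The operator `1 ⊗ |k⟩⟨k'|`. -/
noncomputable def rank (hm : IsHilbertTensor m) (k k' : H₂) : H →L[ℂ] H :=
  (hm.left k).comp (ContinuousLinearMap.adjoint (hm.left k'))

theorem adjoint_left_apply (hm : IsHilbertTensor m) (k : H₂) (h : H₁) (k' : H₂) :
    ContinuousLinearMap.adjoint (hm.left k) (m h k') = ⟪k, k'⟫_ℂ • h := by
  refine ext_inner_left ℂ fun x => ?_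
  rw [ContinuousLinearMap.adjoint_inner_right, hm.left_apply, hm.inner_eq, inner_smul_right,
    mul_comm]

theorem rank_apply (hm : IsHilbertTensor m) (k k' : H₂) (h : H₁) (l : H₂) :
    hm.rank k k' (m h l) = ⟪k', l⟫_ℂ • m h k := by
  simp [rank, hm.adjoint_left_apply]

theorem rank_commute (hm : IsHilbertTensor m) (k k' : H₂) (a : H₁ →L[ℂ] H₁) :
    hm.rank k k' * hm.ampl a = hm.ampl a * hm.rank k k' :=
  hm.ext_clm fun x y => by
    change hm.rank k k' (hm.ampl a (m x y)) = hm.ampl a (hm.rank k k' (m x y))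
    simp [hm.rank_apply]

/-- An operator that commutes with all `1 ⊗ |k⟩⟨k'|` is of the form `a ⊗ 1`. -/
theorem exists_eq_ampl (hm : IsHilbertTensor m) {T : H →L[ℂ] H} {e : H₂} (he : ‖e‖ = 1)
    (h : ∀ k k', hm.rank k k' * T = T * hm.rank k k') : ∃ a, T = hm.ampl a := by
  have hee : ⟪e, e⟫_ℂ = 1 := by rw [inner_self_eq_ofReal, he]; simp
  refine ⟨hm.slice e e T, hm.eq_ampl fun x y => ?_⟩
  -- `m x y` is obtained from `m x e` by the operator `1 ⊗ |y⟩⟨e|`, so the values of `T` on `m x e`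
  -- determine it.
  have h1 : hm.rank y e (T (m x e)) = T (hm.rank y e (m x e)) :=
    congrArg (fun S : H →L[ℂ] H => S (m x e)) (h y e)
  rw [hm.rank_apply, hee, one_smul] at h1
  rw [← h1]
  rfl

/-- The operators `a` with `a ⊗ 1 ∈ A`. -/
noncomputable def reduce (hm : IsHilbertTensor m) (A : VonNeumannAlgebra H) :
    VonNeumannAlgebra H₁ :=
  (generated {s | ∃ T ∈ A.commutant, ∃ k k', s = hm.slice k k' T}).commutant

/-- Being the commutant of the slices of `A'`, the reduction is a von Neumann algebra by
construction; the slice criterion recovers its intended description. -/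
theorem mem_reduce (hm : IsHilbertTensor m) {A : VonNeumannAlgebra H} {a : H₁ →L[ℂ] H₁} :
    a ∈ hm.reduce A ↔ hm.ampl a ∈ A := by
  rw [reduce, mem_commutant_generated, ← A.commutant_commutant, mem_commutant]
  constructor
  · intro h T hT
    rw [A.commutant_commutant] at h
    exact (hm.ampl_commute_iff.2 fun k k' => ((h _ ⟨T, hT, k, k', rfl⟩).1).symm).symm
  · rw [A.commutant_commutant]
    rintro h _ ⟨T, hT, k, k', rfl⟩
    refine ⟨(hm.ampl_commute_iff.1 (h T hT).symm k k').symm, ?_⟩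
    rw [hm.star_slice]
    exact (hm.ampl_commute_iff.1 (h _ (star_mem hT)).symm k' k).symm

theorem slice_mem_commutant_reduce (hm : IsHilbertTensor m) {A : VonNeumannAlgebra H}
    {T : H →L[ℂ] H} (hT : T ∈ A.commutant) (k k' : H₂) :
    hm.slice k k' T ∈ (hm.reduce A).commutant :=
  mem_commutant.2 fun _ ha =>
    hm.ampl_commute_iff.1 (mem_commutant.1 hT _ (hm.mem_reduce.1 ha)) k k'

/-- If `A` consists of operators `a ⊗ 1`, then `n ⊗ 1` commutes with `A` for every `n` in the
commutant of its reduction. -/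
theorem ampl_mem_commutant (hm : IsHilbertTensor m) {A : VonNeumannAlgebra H}
    (hA : ∀ T ∈ A, ∃ a, T = hm.ampl a) {n : H₁ →L[ℂ] H₁} (hn : n ∈ (hm.reduce A).commutant) :
    hm.ampl n ∈ A.commutant := by
  refine mem_commutant.2 fun T hT => ?_
  obtain ⟨a, rfl⟩ := hA T hT
  rw [← hm.ampl_mul, ← hm.ampl_mul, mem_commutant.1 hn a (hm.mem_reduce.2 hT)]

end Amplification

end IsHilbertTensor

end AbstractTensor

/-! ### Conjugation by an antiunitary involution, and modular duality -/

section Sandwich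

variable {H : Type u} [NormedAddCommGroup H] [InnerProductSpace ℂ H] [CompleteSpace H]
  {J : H ≃ₗᵢ⋆[ℂ] H}

theorem sandwich_apply (J : H ≃ₗᵢ⋆[ℂ] H) (a : H →L[ℂ] H) (x : H) :
    sandwich J a x = J (a (J x)) := rfl

theorem sandwich_sandwich (hJ : ∀ x, J (J x) = x) (a : H →L[ℂ] H) :
    sandwich J (sandwich J a) = a := by
  ext x
  simp only [sandwich_apply, hJ]

theorem sandwich_mul (hJ : ∀ x, J (J x) = x) (a b : H →L[ℂ] H) :
    sandwich J (a * b) = sandwich J a * sandwich J b := by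
  ext x
  change J (a (b (J x))) = J (a (J (J (b (J x)))))
  rw [hJ]

theorem symm_apply_of_involutive (hJ : ∀ x, J (J x) = x) (x : H) : J.symm x = J x := by
  rw [LinearIsometryEquiv.symm_apply_eq, hJ]

theorem inner_conj_left (hJ : ∀ x, J (J x) = x) (x y : H) : ⟪J x, y⟫_ℂ = ⟪J y, x⟫_ℂ := by
  rw [antiunitary_inner_left, symm_apply_of_involutive hJ]

theorem sandwich_star (hJ : ∀ x, J (J x) = x) (a : H →L[ℂ] H) :
    sandwich J (star a) = star (sandwich J a) := by
  ext x
  refine ext_inner_right ℂ fun y => ?_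
  rw [star_apply_inner, sandwich_apply, sandwich_apply, inner_conj_left hJ, inner_star_apply,
    ← antiunitary_inner J, hJ]

/-- Conjugation by `J` respects products and adjoints, so `J g J` commutes with `J A J` for each `g
∈ A'`. The bicommutant theorem then shows that generation adds nothing to the operators `J a J`. -/
theorem mem_conjugate (hJ : ∀ x, J (J x) = x) {A : VonNeumannAlgebra H} {T : H →L[ℂ] H} :
    T ∈ conjugate J A ↔ sandwich J T ∈ A := by
  constructor
  · intro h
    rw [← A.commutant_commutant, mem_commutant]
    intro g hg
    have := mem_generated.1 h (sandwich J g) (by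
      rintro _ ⟨a, ha, rfl⟩
      rw [← sandwich_star hJ, ← sandwich_mul hJ, ← sandwich_mul hJ, ← sandwich_mul hJ,
        ← sandwich_mul hJ, mem_commutant.1 hg a ha, mem_commutant.1 hg _ (star_mem ha)]
      exact ⟨rfl, rfl⟩)
    have := congrArg (sandwich J) this
    rwa [sandwich_mul hJ, sandwich_mul hJ, sandwich_sandwich hJ] at this
  · intro h
    exact subset_generated ⟨_, h, sandwich_sandwich hJ T⟩

/-- The Tomita operator of the commutant. -/
theorem IsModularRel.mem_tomitaGraph_of_commutant {N : VonNeumannAlgebra H} {Ω : H}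
    {G : Set (H × H)} (h : IsModularRel N.commutant Ω J G) (x y : H) :
    (x, y) ∈ tomitaGraph N Ω ↔ (J x, y) ∈ G := by
  constructor
  · intro hxy
    -- The claim is `S_N = P J = (J P)*`. This inclusion is formal adjointness; the converse is the
    -- approximation result `mem_tomitaGraph_of_adjoint`.
    rw [h.isPosRel.mem_iff]
    rintro ⟨u, v⟩ huv
    have huv' : (u, J v) ∈ tomitaGraph N.commutant Ω := by
      rwa [h.mem_tomitaGraph_iff, h.apply_apply]
    rw [inner_conj_left h.apply_apply]
    exact tomitaGraph_pair (fun a ha b hb => mem_commutant.1 hb a ha) hxy huv'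
  · intro hxy
    refine mem_tomitaGraph_of_adjoint h.dense_orbit fun c hc => ?_
    rw [← h.isPosRel.symm hxy ((h.mem_tomitaGraph_iff _ _).1 (mem_tomitaGraph hc)),
      antiunitary_inner]

/-- The modular data of `J N J` are those of the commutant of `N`. -/
theorem IsModularRel.of_sandwich {N N' : VonNeumannAlgebra H} {Ω : H}
    {G : Set (H × H)} (h : IsModularRel N.commutant Ω J G)
    (hN : ∀ a, a ∈ N' ↔ sandwich J a ∈ N) : IsModularRel N' Ω J G := by
  have hJ := h.apply_apply
  have hΩ := h.apply_vector
  have key : ∀ a, J ((sandwich J a) Ω) = a Ω := fun a => by rw [sandwich_apply, hΩ, hJ]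
  refine ⟨h.isPosRel, fun x y => ?_, h.single_valued, h.dense_dom⟩
  -- Duality turns the claim into: the Tomita operator of `J N J` is `J S_N J`. This holds on the
  -- core since `J Ω = Ω`.
  rw [symm_apply_of_involutive hJ, ← hJ x, ← h.mem_tomitaGraph_of_commutant, hJ x]
  constructor
  · intro hxy
    refine tomitaGraph_subset (S := {z : H × H | (J z.1, J z.2) ∈ tomitaGraph N Ω})
      (isClosed_tomitaGraph.preimage (by fun_prop)) (fun a ha => ?_) hxy
    have := mem_tomitaGraph (Ω := Ω) ((hN a).1 ha)
    rw [← sandwich_star hJ, sandwich_apply, sandwich_apply, hΩ] at this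
    exact this
  · intro hxy
    have := tomitaGraph_subset (S := {z : H × H | (J z.1, J z.2) ∈ tomitaGraph N' Ω})
      (isClosed_tomitaGraph.preimage (by fun_prop)) (fun a ha => ?_) hxy
    · rw [Set.mem_ofPred_eq, hJ, hJ] at this
      exact this
    · have := mem_tomitaGraph (Ω := Ω) ((hN (sandwich J a)).2 (by rwa [sandwich_sandwich hJ]))
      rw [← sandwich_star hJ, sandwich_apply, sandwich_apply, hΩ] at this
      exact this

end Sandwich

theorem join_comm {H : Type u} [NormedAddCommGroup H] [InnerProductSpace ℂ H] [CompleteSpace H]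
    (A B : VonNeumannAlgebra H) : join A B = join B A := by
  rw [join, join, Set.union_comm]

/-! ### Restricting the modular data of a product vector to one factor -/

section Product

variable {H₁ H₂ H : Type u} [NormedAddCommGroup H₁] [InnerProductSpace ℂ H₁] [CompleteSpace H₁]
  [NormedAddCommGroup H₂] [InnerProductSpace ℂ H₂] [CompleteSpace H₂]
  [NormedAddCommGroup H] [InnerProductSpace ℂ H] [CompleteSpace H]

/-- `A` acts on the first and `B` on the second tensor factor, and `J`, `G` are the modular data of
the commutant of `A ∨ B` with respect to the product vector `Ω₁ ⊗ Ω₂`. -/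
structure IsProductModular (m : H₁ →ₗ[ℂ] H₂ →ₗ[ℂ] H) (A B : VonNeumannAlgebra H) (Ω₁ : H₁)
    (Ω₂ : H₂) (J : H ≃ₗᵢ⋆[ℂ] H) (G : Set (H × H)) : Prop where
  tensor : IsHilbertTensor m
  norm_left : ‖Ω₁‖ = 1
  norm_right : ‖Ω₂‖ = 1
  ampl_left : ∀ T ∈ A, ∃ a, T = tensor.ampl a
  ampl_right : ∀ T ∈ B, ∃ b, T = tensor.flip.ampl b
  modular : IsModularRel (join A B).commutant (m Ω₁ Ω₂) J G

namespace IsProductModular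

variable {m : H₁ →ₗ[ℂ] H₂ →ₗ[ℂ] H} {A B : VonNeumannAlgebra H} {Ω₁ : H₁} {Ω₂ : H₂}
  {J : H ≃ₗᵢ⋆[ℂ] H} {G : Set (H × H)}

theorem flip (h : IsProductModular m A B Ω₁ Ω₂ J G) :
    IsProductModular m.flip B A Ω₂ Ω₁ J G where
  tensor := h.tensor.flip
  norm_left := h.norm_right
  norm_right := h.norm_left
  ampl_left := h.ampl_right
  ampl_right := h.ampl_left
  modular := by rw [join_comm]; exact h.modular

theorem slice_mem (h : IsProductModular m A B Ω₁ Ω₂ J G) {c : H →L[ℂ] H}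
    (hc : c ∈ (join A B).commutant) (k k' : H₂) :
    h.tensor.slice k k' c ∈ (h.tensor.reduce A).commutant :=
  h.tensor.slice_mem_commutant_reduce (mem_commutant_join.1 hc).1 k k'

theorem ampl_mem (h : IsProductModular m A B Ω₁ Ω₂ J G) {n : H₁ →L[ℂ] H₁}
    (hn : n ∈ (h.tensor.reduce A).commutant) : h.tensor.ampl n ∈ (join A B).commutant := by
  refine mem_commutant_join.2 ⟨h.tensor.ampl_mem_commutant h.ampl_left hn, ?_⟩
  refine mem_commutant.2 fun T hT => ?_
  obtain ⟨b, rfl⟩ := h.ampl_right T hT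
  exact (h.tensor.ampl_commute n b).symm

theorem adjoint_left_left (h : IsProductModular m A B Ω₁ Ω₂ J G) (x : H₁) :
    ContinuousLinearMap.adjoint (h.tensor.left Ω₂) (m x Ω₂) = x := by
  rw [h.tensor.adjoint_left_apply, inner_self_eq_ofReal, h.norm_right]
  simp

/-- The Tomita operators of `A ∨ B` and of the reduction are compatible with the projection. -/
theorem adjoint_left_mem (h : IsProductModular m A B Ω₁ Ω₂ J G) {x y : H}
    (hxy : (x, y) ∈ tomitaGraph (join A B).commutant (m Ω₁ Ω₂)) :
    (ContinuousLinearMap.adjoint (h.tensor.left Ω₂) x,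
      ContinuousLinearMap.adjoint (h.tensor.left Ω₂) y) ∈
      tomitaGraph (h.tensor.reduce A).commutant Ω₁ := by
  refine tomitaGraph_subset (S := {z : H × H | (ContinuousLinearMap.adjoint (h.tensor.left Ω₂) z.1,
      ContinuousLinearMap.adjoint (h.tensor.left Ω₂) z.2) ∈
      tomitaGraph (h.tensor.reduce A).commutant Ω₁})
    (isClosed_tomitaGraph.preimage (by fun_prop)) (fun c hc => ?_) hxy
  have := mem_tomitaGraph (Ω := Ω₁) (h.slice_mem hc Ω₂ Ω₂)
  rw [h.tensor.star_slice] at this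
  exact this

theorem left_mem (h : IsProductModular m A B Ω₁ Ω₂ J G) {x y : H₁}
    (hxy : (x, y) ∈ tomitaGraph (h.tensor.reduce A).commutant Ω₁) :
    (m x Ω₂, m y Ω₂) ∈ tomitaGraph (join A B).commutant (m Ω₁ Ω₂) := by
  have hc := h.tensor.continuous_left Ω₂
  refine tomitaGraph_subset (S := {z : H₁ × H₁ | (m z.1 Ω₂, m z.2 Ω₂) ∈
      tomitaGraph (join A B).commutant (m Ω₁ Ω₂)})
    (isClosed_tomitaGraph.preimage ((hc.comp continuous_fst).prodMk (hc.comp continuous_snd)))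
    (fun n hn => ?_) hxy
  have := mem_tomitaGraph (Ω := m Ω₁ Ω₂) (h.ampl_mem hn)
  rwa [← h.tensor.ampl_star, h.tensor.ampl_apply, h.tensor.ampl_apply] at this

/-- `1 ⊗ |Ω₂⟩⟨Ω₂|` compresses to the first factor and embeds back; both maps carry Tomita graphs to
Tomita graphs. -/
theorem rank_mem (h : IsProductModular m A B Ω₁ Ω₂ J G) {x y : H}
    (hxy : (x, y) ∈ tomitaGraph (join A B).commutant (m Ω₁ Ω₂)) :
    (h.tensor.rank Ω₂ Ω₂ x, h.tensor.rank Ω₂ Ω₂ y) ∈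
      tomitaGraph (join A B).commutant (m Ω₁ Ω₂) :=
  h.left_mem (h.adjoint_left_mem hxy)

/-- `J` commutes with the projection `1 ⊗ |Ω₂⟩⟨Ω₂|`. -/
theorem conj_rank (h : IsProductModular m A B Ω₁ Ω₂ J G) (x : H) :
    J (h.tensor.rank Ω₂ Ω₂ x) = h.tensor.rank Ω₂ Ω₂ (J x) := by
  set E := h.tensor.rank Ω₂ Ω₂ with hE
  have hEE : ∀ x, E (E x) = E x := fun x =>
    congrArg (h.tensor.left Ω₂) (h.adjoint_left_left _)
  have hEs : ∀ x y, ⟪E x, y⟫_ℂ = ⟪x, E y⟫_ℂ := fun x y => by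
    simp only [hE, IsHilbertTensor.rank, ContinuousLinearMap.comp_apply]
    rw [← ContinuousLinearMap.adjoint_inner_right, ContinuousLinearMap.adjoint_inner_left]
  -- The reflection `2E - 1` is a unitary involution preserving the Tomita graph, so the commutation
  -- result for unitaries applies to it.
  let V : H →ₗ[ℂ] H := (E + E - 1 : H →L[ℂ] H)
  have hVa : ∀ x, V x = E x + E x - x := fun x => rfl
  have hVV : ∀ x, V (V x) = x := fun x => by
    simp only [hVa, map_add, map_sub, hEE]; abel
  have hVn : ∀ x, ‖V x‖ = ‖x‖ := fun x => by
    have hVs : ∀ x y, ⟪V x, y⟫_ℂ = ⟪x, V y⟫_ℂ := fun x y => by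
      rw [hVa, hVa]
      simp only [inner_add_left, inner_sub_left, inner_add_right, inner_sub_right, hEs]
    have : ⟪V x, V x⟫_ℂ = ⟪x, x⟫_ℂ := by rw [hVs, hVV]
    rw [@norm_eq_sqrt_re_inner ℂ, @norm_eq_sqrt_re_inner ℂ, this]
  let U : H ≃ₗᵢ[ℂ] H := ⟨LinearEquiv.ofInvolutive V hVV, hVn⟩
  have hJU := h.modular.commute_of_preserves U hVV (fun x y hxy => ?_) x
  · change J (E x + E x - x) = E (J x) + E (J x) - J x at hJU
    rw [map_sub, map_add, sub_left_inj, ← two_smul ℂ, ← two_smul ℂ (E (J x))] at hJU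
    exact smul_right_injective H two_ne_zero hJU
  · exact tomitaGraph_sub (tomitaGraph_add (h.rank_mem hxy) (h.rank_mem hxy)) hxy

/-- Since `J` commutes with the projection onto `H₁ ⊗ Ω₂`, it preserves that subspace, and its
compression is again antiunitary. -/
theorem exists_conj_left (h : IsProductModular m A B Ω₁ Ω₂ J G) :
    ∃ J₁ : H₁ ≃ₗᵢ⋆[ℂ] H₁, ∀ x, m (J₁ x) Ω₂ = J (m x Ω₂) := by
  have hJ := h.modular.apply_apply
  let L := h.tensor.left Ω₂
  let L' := ContinuousLinearMap.adjoint L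
  have hL : ∀ x, L (L' (J (L x))) = J (L x) := fun x => by
    have := h.conj_rank (L x)
    change J (L (L' (L x))) = L (L' (J (L x))) at this
    rw [← this]
    exact congrArg (fun w => J (L w)) (h.adjoint_left_left x)
  have hLL : ∀ x, L' (L x) = x := h.adjoint_left_left
  have hLn : ∀ x, ‖L x‖ = ‖x‖ := fun x => by
    change ‖m x Ω₂‖ = _
    rw [h.tensor.norm_apply, h.norm_right, mul_one]
  have hinv : ∀ x, L' (J (L (L' (J (L x))))) = x := fun x => by rw [hL, hJ, hLL]
  let e : H₁ ≃ₗ⋆[ℂ] H₁ :=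
    { toFun := fun x => L' (J (L x))
      invFun := fun x => L' (J (L x))
      map_add' := fun x y => by simp
      map_smul' := fun c x => by rw [map_smul, J.map_smulₛₗ, map_smul]
      left_inv := hinv
      right_inv := hinv }
  refine ⟨⟨e, fun x => ?_⟩, fun x => hL x⟩
  rw [← hLn]
  change ‖L (L' (J (L x)))‖ = _
  rw [hL, J.norm_map, hLn]

/-- The positive relation is reduced by the projection onto `H₁ ⊗ Ω₂`, since both `S` and `J`
respect it. Its part there is therefore still self-adjoint and densely defined. -/
theorem isModularRel_left (h : IsProductModular m A B Ω₁ Ω₂ J G) {J₁ : H₁ ≃ₗᵢ⋆[ℂ] H₁}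
    (hJ₁ : ∀ x, m (J₁ x) Ω₂ = J (m x Ω₂)) :
    IsModularRel (h.tensor.reduce A).commutant Ω₁ J₁ {z | (m z.1 Ω₂, m z.2 Ω₂) ∈ G} := by
  have hJ := h.modular.apply_apply
  let L := h.tensor.left Ω₂
  let L' := ContinuousLinearMap.adjoint L
  have hLL : ∀ x, L' (L x) = x := h.adjoint_left_left
  have hLinj : Function.Injective L := fun x y hxy => by rw [← hLL x, hxy, hLL]
  have hJ₁s : ∀ x, L (J₁.symm x) = J.symm (L x) := fun x => by
    rw [LinearIsometryEquiv.eq_symm_apply]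
    change J (m (J₁.symm x) Ω₂) = m x Ω₂
    rw [← hJ₁, J₁.apply_symm_apply]
  have hG : ∀ {u v}, (u, v) ∈ G → (L (L' u), L (L' v)) ∈ G := by
    intro u v huv
    have h1 : (u, J v) ∈ tomitaGraph (join A B).commutant (m Ω₁ Ω₂) := by
      rwa [h.modular.mem_tomitaGraph_iff, hJ]
    have h2 := h.rank_mem h1
    rw [← h.conj_rank, h.modular.mem_tomitaGraph_iff, hJ] at h2
    exact h2
  refine ⟨⟨fun x y => ?_, fun z hz => ?_⟩, fun x y => ?_, fun y hy => ?_, ?_⟩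
  · change (L x, L y) ∈ G ↔ _
    rw [h.modular.isPosRel.mem_iff]
    constructor
    · rintro hxy ⟨u, v⟩ huv
      have := hxy _ huv
      simp only at this ⊢
      rw [← hLL v, ← hLL u, ContinuousLinearMap.adjoint_inner_right,
        ContinuousLinearMap.adjoint_inner_right]
      exact this
    · rintro hxy ⟨u, v⟩ huv
      have := hxy (L' u, L' v) (hG huv)
      simp only at this ⊢
      rwa [ContinuousLinearMap.adjoint_inner_right, ContinuousLinearMap.adjoint_inner_right] at this
  · have := h.modular.isPosRel.nonneg _ hz
    simp only [h.tensor.inner_eq, inner_self_eq_ofReal, h.norm_right] at this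
    simpa using this
  · change _ ↔ (L x, L (J₁.symm y)) ∈ G
    rw [hJ₁s, ← h.modular.mem_iff]
    refine ⟨h.left_mem, fun hxy => ?_⟩
    have := h.adjoint_left_mem hxy
    change (L' (L x), L' (L y)) ∈ _ at this
    rwa [hLL, hLL] at this
  · refine hLinj ?_
    rw [map_zero]
    refine h.modular.single_valued _ ?_
    have : (L 0, L y) ∈ G := hy
    rwa [map_zero] at this
  · have hsur : Function.Surjective L' := fun x => ⟨L x, hLL x⟩
    refine (hsur.denseRange.dense_image L'.continuous h.modular.dense_dom).mono ?_
    rintro _ ⟨x, ⟨y, hxy⟩, rfl⟩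
    exact ⟨L' y, hG hxy⟩

end IsProductModular

end Product

/-! ### The modular conjugation of a product vector is a tensor product -/

section Product

variable {H₁ H₂ H : Type u} [NormedAddCommGroup H₁] [InnerProductSpace ℂ H₁] [CompleteSpace H₁]
  [NormedAddCommGroup H₂] [InnerProductSpace ℂ H₂] [CompleteSpace H₂]
  [NormedAddCommGroup H] [InnerProductSpace ℂ H] [CompleteSpace H]

variable {m : H₁ →ₗ[ℂ] H₂ →ₗ[ℂ] H}

/-- The tensor product of Tomita operators. -/
theorem IsHilbertTensor.tomitaGraph_tensor (hm : IsHilbertTensor m) {P : VonNeumannAlgebra H₁}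
    {Q : VonNeumannAlgebra H₂} {R : VonNeumannAlgebra H} (hP : ∀ a ∈ P, hm.ampl a ∈ R)
    (hQ : ∀ b ∈ Q, hm.flip.ampl b ∈ R) {Ω₁ x y : H₁} {Ω₂ u v : H₂}
    (h₁ : (x, y) ∈ tomitaGraph P Ω₁) (h₂ : (u, v) ∈ tomitaGraph Q Ω₂) :
    (m x u, m y v) ∈ tomitaGraph R (m Ω₁ Ω₂) := by
  have c₁ := hm.continuous_left
  have c₂ := hm.continuous_right
  refine tomitaGraph_subset (S := {z : H₁ × H₁ | (m z.1 u, m z.2 v) ∈ tomitaGraph R (m Ω₁ Ω₂)})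
    (isClosed_tomitaGraph.preimage
      (((c₁ _).comp continuous_fst).prodMk ((c₁ _).comp continuous_snd))) (fun a ha => ?_) h₁
  refine tomitaGraph_subset
    (S := {z : H₂ × H₂ | (m (a Ω₁) z.1, m ((star a) Ω₁) z.2) ∈ tomitaGraph R (m Ω₁ Ω₂)})
    (isClosed_tomitaGraph.preimage
      (((c₂ _).comp continuous_fst).prodMk ((c₂ _).comp continuous_snd))) (fun b hb => ?_) h₂
  have := mem_tomitaGraph (Ω := m Ω₁ Ω₂) (mul_mem (hP a ha) (hQ b hb))
  rw [hm.ampl_commute, star_mul, ← hm.ampl_star, ← hm.flip.ampl_star] at this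
  change (hm.flip.ampl b (hm.ampl a (m Ω₁ Ω₂)),
    hm.ampl (star a) (hm.flip.ampl (star b) (m Ω₁ Ω₂))) ∈ _ at this
  rwa [hm.ampl_apply, hm.flip_ampl_apply, hm.flip_ampl_apply, hm.ampl_apply] at this

theorem IsHilbertTensor.eq_zero_of_ampl (hm : IsHilbertTensor m) {b : H₁ →L[ℂ] H₁}
    (sb : star b = b) (kb : ∀ h, b h = 0 → h = 0) {z : H} (hz : hm.ampl b z = 0) : z = 0 := by
  have h1 : ∀ k, ContinuousLinearMap.adjoint (hm.left k) z = 0 := fun k => by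
    refine kb _ (ext_inner_left ℂ fun h => ?_)
    rw [← star_apply_inner, sb, ContinuousLinearMap.adjoint_inner_right, hm.left_apply,
      ← hm.ampl_apply, ← sb, hm.ampl_star, star_apply_inner, hz, inner_zero_right, inner_zero_right]
  refine hm.ext_inner fun h k => ?_
  rw [← hm.left_apply, ← ContinuousLinearMap.adjoint_inner_right, h1, inner_zero_right,
    inner_zero_right]

/-- The product of the resolvents of a positive self-adjoint relation is a square. -/
theorem IsPosRel.exists_eq_star_mul {G : Set (H × H)} (hG : IsPosRel G) {B C : H →L[ℂ] H}
    (sB : IsSelfAdjoint B) (sC : IsSelfAdjoint C) (hB : ∀ h, (B h, C h) ∈ G) :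
    B * C = C * B ∧ ∃ d, B * C = star d * d := by
  have sB := ContinuousLinearMap.isSelfAdjoint_iff_isSymmetric.1 sB
  have sC := ContinuousLinearMap.isSelfAdjoint_iff_isSymmetric.1 sC
  have hc : B * C = C * B := by
    ext h
    refine ext_inner_left ℂ fun k => ?_
    have e1 : ⟪k, B (C h)⟫_ℂ = ⟪B k, C h⟫_ℂ := (sB k (C h)).symm
    have e2 : ⟪k, C (B h)⟫_ℂ = ⟪C k, B h⟫_ℂ := (sC k (B h)).symm
    exact (e1.trans (hG.symm (hB k) (hB h))).trans e2.symm
  refine ⟨hc, CStarAlgebra.nonneg_iff_eq_star_mul_self.1 ?_⟩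
  rw [ContinuousLinearMap.nonneg_iff_isPositive, ContinuousLinearMap.isPositive_def]
  refine ⟨fun h k => ?_, fun h => ?_⟩
  · have e1 : ⟪B (C h), k⟫_ℂ = ⟪C h, B k⟫_ℂ := sB (C h) k
    have e2 : ⟪h, C (B k)⟫_ℂ = ⟪C h, B k⟫_ℂ := (sC h (B k)).symm
    have e3 : B (C k) = C (B k) := congrArg (fun T : H →L[ℂ] H => T k) hc
    change ⟪B (C h), k⟫_ℂ = ⟪h, B (C k)⟫_ℂ
    rw [e1, e3, e2]
  · rw [ContinuousLinearMap.reApplyInnerSelf_apply]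
    have e1 : ⟪B (C h), h⟫_ℂ = ⟪C h, B h⟫_ℂ := sB (C h) h
    change 0 ≤ (⟪B (C h), h⟫_ℂ).re
    rw [e1, ← inner_conj_symm, Complex.conj_re]
    exact hG.nonneg _ (hB h)

namespace IsProductModular

variable {A B : VonNeumannAlgebra H} {Ω₁ : H₁} {Ω₂ : H₂} {J : H ≃ₗᵢ⋆[ℂ] H} {G : Set (H × H)}

/-- The modular conjugation of a product state is the tensor product of its restrictions. -/
theorem conj_tensor (h : IsProductModular m A B Ω₁ Ω₂ J G) {J₁ : H₁ ≃ₗᵢ⋆[ℂ] H₁}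
    {J₂ : H₂ ≃ₗᵢ⋆[ℂ] H₂} (hJ₁ : ∀ x, m (J₁ x) Ω₂ = J (m x Ω₂))
    (hJ₂ : ∀ y, m Ω₁ (J₂ y) = J (m Ω₁ y)) (x : H₁) (y : H₂) : J (m x y) = m (J₁ x) (J₂ y) := by
  have hm := h.tensor
  have r₁ := h.isModularRel_left hJ₁
  have r₂ := h.flip.isModularRel_left (J₁ := J₂) hJ₂
  obtain ⟨B₁, C₁, sB₁, sC₁, -, hB₁, hC₁⟩ := r₁.isPosRel.exists_resolvent
  obtain ⟨B₂, C₂, sB₂, sC₂, -, hB₂, hC₂⟩ := r₂.isPosRel.exists_resolvent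
  obtain ⟨c₁, d₁, hd₁⟩ := r₁.isPosRel.exists_eq_star_mul sB₁ sC₁ hB₁
  obtain ⟨c₂, d₂, hd₂⟩ := r₂.isPosRel.exists_eq_star_mul sB₂ sC₂ hB₂
  obtain ⟨J', hJ'⟩ := hm.exists_conj J₁ J₂
  have tens : ∀ (a a' : H₁ →L[ℂ] H₁) (b b' : H₂ →L[ℂ] H₂),
      (hm.ampl a * hm.flip.ampl b) * (hm.ampl a' * hm.flip.ampl b')
        = hm.ampl (a * a') * hm.flip.ampl (b * b') := by
    intro a a' b b'
    rw [hm.ampl_mul, hm.flip.ampl_mul, mul_assoc, ← mul_assoc (hm.flip.ampl b),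
      ← hm.ampl_commute]
    simp only [mul_assoc]
  have tstar : ∀ (a : H₁ →L[ℂ] H₁) (b : H₂ →L[ℂ] H₂),
      star (hm.ampl a * hm.flip.ampl b) = hm.ampl (star a) * hm.flip.ampl (star b) := by
    intro a b
    rw [star_mul, ← hm.ampl_star, ← hm.flip.ampl_star, hm.ampl_commute]
  have tapp : ∀ (a : H₁ →L[ℂ] H₁) (b : H₂ →L[ℂ] H₂) x y,
      (hm.ampl a * hm.flip.ampl b) (m x y) = m (a x) (b y) := by
    intro a b x y
    change hm.ampl a (hm.flip.ampl b (m x y)) = _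
    rw [hm.flip_ampl_apply, hm.ampl_apply]
  -- `P₁ ⊗ P₂` is realised as `Y X⁻¹`, the tensor product of the quotients `C₁ B₁⁻¹` and `C₂ B₂⁻¹`.
  set X := hm.ampl B₁ * hm.flip.ampl B₂ with hX
  set Y := hm.ampl C₁ * hm.flip.ampl C₂ with hY
  have stX : star X = X := by rw [hX, tstar, sB₁.star_eq, sB₂.star_eq]
  have stY : star Y = Y := by rw [hY, tstar, sC₁.star_eq, sC₂.star_eq]
  have sX : ∀ z w, ⟪X z, w⟫_ℂ = ⟪z, X w⟫_ℂ := fun z w => by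
    conv_lhs => rw [← stX]
    exact star_apply_inner X z w
  have sY : ∀ z w, ⟪Y z, w⟫_ℂ = ⟪z, Y w⟫_ℂ := fun z w => by
    conv_lhs => rw [← stY]
    exact star_apply_inner Y z w
  have hXY : ∀ z, X (Y z) = Y (X z) := fun z => by
    have : X * Y = Y * X := by rw [hX, hY, tens, tens, c₁, c₂]
    exact congrArg (fun T : H →L[ℂ] H => T z) this
  have kX : ∀ z, X z = 0 → z = 0 := fun z hz =>
    hm.flip.eq_zero_of_ampl sB₂.star_eq
      (fun _ => r₂.isPosRel.eq_zero_of_resolvent r₂.single_valued hB₂ hC₂)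
      (hm.eq_zero_of_ampl sB₁.star_eq
        (fun _ => r₁.isPosRel.eq_zero_of_resolvent r₁.single_valued hB₁ hC₁) hz)
  -- `X Y = B₁C₁ ⊗ B₂C₂`, and each factor has the form `d* d`, so the product does too.
  have hpos : ∀ ζ, 0 ≤ (⟪X ζ, Y ζ⟫_ℂ).re := fun ζ => by
    have e : X * Y = star (hm.ampl d₁ * hm.flip.ampl d₂) * (hm.ampl d₁ * hm.flip.ampl d₂) := by
      rw [hX, hY, tens, tstar, tens, hd₁, hd₂]
    have e' : ⟪ζ, (X * Y) ζ⟫_ℂ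
        = ⟪(hm.ampl d₁ * hm.flip.ampl d₂) ζ, (hm.ampl d₁ * hm.flip.ampl d₂) ζ⟫_ℂ := by
      rw [e]
      exact inner_star_apply _ _ _
    rw [sX]
    change 0 ≤ (⟪ζ, (X * Y) ζ⟫_ℂ).re
    rw [e', inner_self_eq_ofReal, Complex.ofReal_re]
    positivity
  have hQ := isPosRel_quotient sX sY hXY kX hpos
  -- elementary tensors
  have hT : ∀ ζ, (X ζ, J' (Y ζ)) ∈ tomitaGraph (join A B).commutant (m Ω₁ Ω₂) := by
    have hel : ∀ a b, (X (m a b), J' (Y (m a b))) ∈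
        tomitaGraph (join A B).commutant (m Ω₁ Ω₂) := by
      intro a b
      rw [hX, hY, tapp, tapp, hJ']
      refine hm.tomitaGraph_tensor (fun _ => h.ampl_mem) (fun b hb => ?_) ?_ ?_
        (P := (hm.reduce A).commutant) (Q := (hm.flip.reduce B).commutant)
      · rw [join_comm]
        exact h.flip.ampl_mem hb
      · rw [r₁.mem_tomitaGraph_iff, r₁.apply_apply]
        exact hB₁ a
      · have := (r₂.mem_tomitaGraph_iff (B₂ b) (J₂ (C₂ b))).2
          (by rw [r₂.apply_apply]; exact hB₂ b)
        exact this
    intro ζ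
    have hcl : IsClosed {ζ | (X ζ, J' (Y ζ)) ∈ tomitaGraph (join A B).commutant (m Ω₁ Ω₂)} :=
      isClosed_tomitaGraph.preimage (by fun_prop)
    refine closure_minimal ?_ hcl (hm.dense ζ)
    intro ξ hξ
    induction hξ using Submodule.span_induction with
    | mem x hx => obtain ⟨a, b, rfl⟩ := hx; exact hel a b
    | zero => simpa using hel 0 0
    | add x y _ _ hx hy =>
      have := tomitaGraph_add hx hy
      rwa [← map_add, ← map_add, ← map_add] at this
    | smul c x _ hx =>
      have := tomitaGraph_smul c hx
      rwa [← map_smul, ← J'.map_smulₛₗ, ← map_smul] at this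
  have hJJ : J = J' := by
    refine h.modular.isPosRel.conj_unique hQ h.modular.single_valued h.modular.dense_range _ _
      fun z w => ?_
    rw [← h.modular.mem_iff]
    constructor
    · intro hzw
      change Y z = X (J'.symm w)
      refine hm.ext_inner fun a b => ?_
      rw [← sX, ← sY, hX, hY, tapp, tapp, ← antiunitary_inner J' (J'.symm w),
        J'.apply_symm_apply, hJ']
      -- By duality on each factor these are points of the Tomita graph of `A ∨ B`. Pairing them
      -- with `(z, w)` is the equation `Y z = X J'⁻¹ w` tested on `m a b`.
      have hj : (m (J₁ (B₁ a)) (J₂ (B₂ b)), m (C₁ a) (C₂ b)) ∈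
          tomitaGraph (join A B) (m Ω₁ Ω₂) := by
        refine hm.tomitaGraph_tensor (fun a ha => left_mem_join (hm.mem_reduce.1 ha))
          (fun b hb => right_mem_join (hm.flip.mem_reduce.1 hb)) ?_ ?_
        · rw [r₁.mem_tomitaGraph_of_commutant, r₁.apply_apply]
          exact hB₁ a
        · have := (r₂.mem_tomitaGraph_of_commutant (J₂ (B₂ b)) (C₂ b)).2
            (by rw [r₂.apply_apply]; exact hB₂ b)
          exact this
      exact (tomitaGraph_pair (fun a ha b hb => mem_commutant.1 hb a ha) hj hzw).symm
    · intro hzw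
      -- Conversely the pairs `(X ζ, Y ζ)` form a core of the quotient, and `hT` places their images
      -- in the closed Tomita graph.
      have := mem_of_quotient_core
        (S := {z : H × H | (z.1, J' z.2) ∈ tomitaGraph (join A B).commutant (m Ω₁ Ω₂)})
        sX sY hXY kX (isClosed_tomitaGraph.preimage (by fun_prop)) hT hzw
      simpa using this
  rw [hJJ, hJ']

end IsProductModular

end Product

/-! ### The relative commutant of `N ∨ J N J` -/

section Factor

variable {H : Type u} [NormedAddCommGroup H] [InnerProductSpace ℂ H] [CompleteSpace H]

/-- An operator `x` such that `x` and `J x J` commute with `N` satisfies `J x J = x*`. -/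
theorem IsModularRel.sandwich_eq_star {N : VonNeumannAlgebra H} {Ω : H} {J : H ≃ₗᵢ⋆[ℂ] H}
    {G : Set (H × H)} (h : IsModularRel N.commutant Ω J G) (hcyc : IsCyclic N Ω) {x : H →L[ℂ] H}
    (hx : x ∈ N.commutant) (hx' : sandwich J x ∈ N.commutant) : sandwich J x = star x := by
  have hJ := h.apply_apply
  have hΩ := h.apply_vector
  have h1 : (x Ω, J ((star x) Ω)) ∈ G := (h.mem_tomitaGraph_iff _ _).1 (mem_tomitaGraph hx)
  have h2 : (J (x Ω), (star x) Ω) ∈ G := by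
    have := (h.mem_tomitaGraph_iff _ _).1 (mem_tomitaGraph (Ω := Ω) hx')
    rwa [← sandwich_star hJ, sandwich_apply, sandwich_apply, hΩ, hJ] at this
  -- The Tomita operator acts on both `x Ω` and `J x J Ω`. Reflecting the second relation by `J`
  -- yields the swap of the first, so positivity gives `x Ω = J x* Ω`.
  have h3 : (J ((star x) Ω), x Ω) ∈ G := by
    have := h.conj_swap_mem h2
    rwa [hJ] at this
  have h4 := h.isPosRel.eq_of_swap_mem h1 h3
  have hsep := hcyc.isSeparating (N := N.commutant) fun a ha b hb => mem_commutant.1 hb a ha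
  refine sub_eq_zero.1 (hsep _ (sub_mem hx' (star_mem hx)) ?_)
  rw [sub_apply, sandwich_apply, hΩ, h4, hJ, sub_self]

/-- The relative commutant of `N ∨ J N J` is abelian. -/
theorem IsModularRel.commute_of_mem {N : VonNeumannAlgebra H} {Ω : H} {J : H ≃ₗᵢ⋆[ℂ] H}
    {G : Set (H × H)} (h : IsModularRel N.commutant Ω J G) (hcyc : IsCyclic N Ω)
    {x y : H →L[ℂ] H} (hx : x ∈ N.commutant) (hx' : sandwich J x ∈ N.commutant)
    (hy : y ∈ N.commutant) (hy' : sandwich J y ∈ N.commutant) : x * y = y * x := by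
  have hJ := h.apply_apply
  -- On these operators the adjoint equals conjugation by `J`. The former reverses products and the
  -- latter preserves them.
  have e := h.sandwich_eq_star hcyc (mul_mem hx hy)
    (by rw [sandwich_mul hJ]; exact mul_mem hx' hy')
  rw [sandwich_mul hJ, h.sandwich_eq_star hcyc hx hx', h.sandwich_eq_star hcyc hy hy',
    ← star_mul] at e
  exact (star_injective e).symm

end Factor

/-! ### The factor condition yields all operators on the first factor -/

section Product

variable {H₁ H₂ H : Type u} [NormedAddCommGroup H₁] [InnerProductSpace ℂ H₁] [CompleteSpace H₁]
  [NormedAddCommGroup H₂] [InnerProductSpace ℂ H₂] [CompleteSpace H₂]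
  [NormedAddCommGroup H] [InnerProductSpace ℂ H] [CompleteSpace H]
  {m : H₁ →ₗ[ℂ] H₂ →ₗ[ℂ] H}
  {A B : VonNeumannAlgebra H} {Ω₁ : H₁} {Ω₂ : H₂} {J : H ≃ₗᵢ⋆[ℂ] H} {G : Set (H × H)}

namespace IsProductModular

theorem sandwich_ampl (h : IsProductModular m A B Ω₁ Ω₂ J G) {J₁ : H₁ ≃ₗᵢ⋆[ℂ] H₁}
    {J₂ : H₂ ≃ₗᵢ⋆[ℂ] H₂} (hJ : ∀ x y, J (m x y) = m (J₁ x) (J₂ y)) (hJ₂ : ∀ y, J₂ (J₂ y) = y)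
    (a : H₁ →L[ℂ] H₁) : sandwich J (h.tensor.ampl a) = h.tensor.ampl (sandwich J₁ a) :=
  h.tensor.eq_ampl fun x y => by
    rw [sandwich_apply, hJ, h.tensor.ampl_apply, hJ, hJ₂]
    rfl

theorem mem_reduce_conjugate (h : IsProductModular m A B Ω₁ Ω₂ J G) {J₁ : H₁ ≃ₗᵢ⋆[ℂ] H₁}
    {J₂ : H₂ ≃ₗᵢ⋆[ℂ] H₂} (hJ : ∀ x y, J (m x y) = m (J₁ x) (J₂ y)) (hJ₂ : ∀ y, J₂ (J₂ y) = y)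
    (a : H₁ →L[ℂ] H₁) :
    a ∈ h.tensor.reduce (conjugate J A) ↔ sandwich J₁ a ∈ h.tensor.reduce A := by
  rw [h.tensor.mem_reduce, h.tensor.mem_reduce, mem_conjugate h.modular.apply_apply,
    h.sandwich_ampl hJ hJ₂]

theorem conjugate_ampl (h : IsProductModular m A B Ω₁ Ω₂ J G) {J₁ : H₁ ≃ₗᵢ⋆[ℂ] H₁}
    {J₂ : H₂ ≃ₗᵢ⋆[ℂ] H₂} (hJ : ∀ x y, J (m x y) = m (J₁ x) (J₂ y)) (hJ₂ : ∀ y, J₂ (J₂ y) = y) :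
    ∀ T ∈ conjugate J A, ∃ a, T = h.tensor.ampl a := by
  intro T hT
  obtain ⟨a, ha⟩ := h.ampl_left _ ((mem_conjugate h.modular.apply_apply).1 hT)
  refine ⟨sandwich J₁ a, ?_⟩
  rw [← h.sandwich_ampl hJ hJ₂, ← ha, sandwich_sandwich h.modular.apply_apply]

/-- If `A ∨ J A J` is a factor, it consists of all operators `a ⊗ 1`. -/
theorem mem_join_conjugate (h : IsProductModular m A B Ω₁ Ω₂ J G) {J₁ : H₁ ≃ₗᵢ⋆[ℂ] H₁}
    {J₂ : H₂ ≃ₗᵢ⋆[ℂ] H₂} (hJ₁ : ∀ x, m (J₁ x) Ω₂ = J (m x Ω₂))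
    (hJ : ∀ x y, J (m x y) = m (J₁ x) (J₂ y)) (hJ₂ : ∀ y, J₂ (J₂ y) = y)
    (hcyc : IsCyclic (h.tensor.reduce A) Ω₁) (hf : IsFactor (join A (conjugate J A)))
    (T : H →L[ℂ] H) : T ∈ join A (conjugate J A) ↔ ∃ a, T = h.tensor.ampl a := by
  have hm := h.tensor
  have r₁ := h.isModularRel_left hJ₁
  have hJ₁J₁ := r₁.apply_apply
  -- the slices of the commutant
  have hs : ∀ S ∈ (join A (conjugate J A)).commutant, ∀ k k',
      hm.slice k k' S ∈ (hm.reduce A).commutant ∧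
        sandwich J₁ (hm.slice k k' S) ∈ (hm.reduce A).commutant := by
    intro S hS k k'
    obtain ⟨h1, h2⟩ := mem_commutant_join.1 hS
    refine ⟨hm.slice_mem_commutant_reduce h1 k k', mem_commutant.2 fun g hg => ?_⟩
    have h3 := hm.slice_mem_commutant_reduce h2 k k'
    have h4 := mem_commutant.1 h3 (sandwich J₁ g)
      ((h.mem_reduce_conjugate hJ hJ₂ _).2 (by rwa [sandwich_sandwich hJ₁J₁]))
    have := congrArg (sandwich J₁) h4
    rwa [sandwich_mul hJ₁J₁, sandwich_mul hJ₁J₁, sandwich_sandwich hJ₁J₁] at this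
  have hmem : ∀ a, (∀ S ∈ (join A (conjugate J A)).commutant, ∀ k k',
      a * hm.slice k k' S = hm.slice k k' S * a) → hm.ampl a ∈ join A (conjugate J A) := by
    intro a ha
    rw [← (join A (conjugate J A)).commutant_commutant, mem_commutant]
    exact fun S hS => (hm.ampl_commute_iff.2 (ha S hS)).symm
  have hA : ∀ S ∈ A, ∃ a, S = hm.ampl a := h.ampl_left
  have hA' := h.conjugate_ampl hJ hJ₂
  -- Slices of the commutant commute among themselves, so each amplified slice lies in the algebra;
  -- it also commutes with both generators. It is central, hence scalar.
  have hscal : ∀ S ∈ (join A (conjugate J A)).commutant, ∀ k k', ∃ c : ℂ,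
      hm.slice k k' S = c • (1 : H₁ →L[ℂ] H₁) := by
    intro S hS k k'
    obtain ⟨h1, h2⟩ := hs S hS k k'
    have hin : hm.ampl (hm.slice k k' S) ∈ join A (conjugate J A) :=
      hmem _ fun S' hS' l l' => by
        obtain ⟨h3, h4⟩ := hs S' hS' l l'
        exact r₁.commute_of_mem hcyc h1 h2 h3 h4
    have hout : hm.ampl (hm.slice k k' S) ∈ (join A (conjugate J A)).commutant :=
      mem_commutant_join.2 ⟨hm.ampl_mem_commutant hA h1,
        hm.ampl_mem_commutant hA'
          (hm.slice_mem_commutant_reduce (mem_commutant_join.1 hS).2 k k')⟩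
    obtain ⟨c, hc⟩ := hf _ hin hout
    refine ⟨c, hm.ampl_injective (k := Ω₂) (fun h0 => ?_) ?_⟩
    · have := h.norm_right
      rw [h0, norm_zero] at this
      exact zero_ne_one this
    · rw [hc, hm.ampl_smul]
      congr 1
      exact hm.eq_ampl fun x y => rfl
  constructor
  · intro hT
    refine hm.exists_eq_ampl h.norm_right fun k k' => ?_
    have : hm.rank k k' ∈ (join A (conjugate J A)).commutant := by
      refine mem_commutant_join.2 ⟨mem_commutant.2 fun S hS => ?_, mem_commutant.2 fun S hS => ?_⟩
      · obtain ⟨a, rfl⟩ := hA S hS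
        exact (hm.rank_commute k k' a).symm
      · obtain ⟨a, rfl⟩ := hA' S hS
        exact (hm.rank_commute k k' a).symm
    exact (mem_commutant.1 this T hT).symm
  · rintro ⟨a, rfl⟩
    refine hmem a fun S hS k k' => ?_
    obtain ⟨c, hc⟩ := hscal S hS k k'
    rw [hc, mul_smul_comm, smul_mul_assoc, mul_one, one_mul]

end IsProductModular

end Product

/-- A bilinear map that is isometric in the second variable extends from a dense range. -/
theorem exists_bilinear_extension {E K₁ K₂ F : Type*} [AddCommGroup E] [Module ℂ E]
    [NormedAddCommGroup K₁] [NormedSpace ℂ K₁] [NormedAddCommGroup K₂] [NormedSpace ℂ K₂]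
    [NormedAddCommGroup F] [NormedSpace ℂ F] [CompleteSpace F] (f : E →ₗ[ℂ] (K₁ →L[ℂ] F))
    (e : E →ₗ[ℂ] K₂) (he : DenseRange e) (hf : ∀ b h, ‖f b h‖ ≤ ‖e b‖ * ‖h‖) :
    ∃ L : K₂ →L[ℂ] (K₁ →L[ℂ] F), ∀ b h, L (e b) h = f b h :=
  ⟨f.extendOfNorm e, fun b h => congrArg (fun S : K₁ →L[ℂ] F => S h)
    (LinearMap.extendOfNorm_eq he ⟨1, fun b => by
      rw [one_mul]
      exact ContinuousLinearMap.opNorm_le_bound _ (norm_nonneg _) (hf b)⟩ b)⟩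

/-! ### Tensor decomposition from a product state -/

section Orbit

variable {H : Type u} [NormedAddCommGroup H] [InnerProductSpace ℂ H] [CompleteSpace H]

/-- The map `a ↦ a Ω`. -/
noncomputable def orbitMap (A : VonNeumannAlgebra H) (Ω : H) : A.toStarSubalgebra →ₗ[ℂ] H where
  toFun a := (a : H →L[ℂ] H) Ω
  map_add' _ _ := rfl
  map_smul' _ _ := rfl

/-- The closure of `A Ω`. -/
noncomputable def orbit (A : VonNeumannAlgebra H) (Ω : H) : Submodule ℂ H :=
  (LinearMap.range (orbitMap A Ω)).topologicalClosure

variable {A : VonNeumannAlgebra H} {Ω : H}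

instance : CompleteSpace (orbit A Ω) :=
  (LinearMap.range (orbitMap A Ω)).isClosed_topologicalClosure.completeSpace_coe

theorem apply_mem_orbit {a : H →L[ℂ] H} (ha : a ∈ A) : a Ω ∈ orbit A Ω :=
  Submodule.le_topologicalClosure _ ⟨⟨a, ha⟩, rfl⟩

theorem self_mem_orbit : Ω ∈ orbit A Ω := apply_mem_orbit (one_mem A)

theorem mem_orbit_of_mem {a : H →L[ℂ] H} (ha : a ∈ A) {x : H} (hx : x ∈ orbit A Ω) :
    a x ∈ orbit A Ω := by
  refine map_mem_closure a.continuous hx ?_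
  rintro _ ⟨⟨b, hb⟩, rfl⟩
  exact ⟨⟨a * b, mul_mem ha hb⟩, rfl⟩

/-- The map `a ↦ a Ω` into the closure of its range. -/
noncomputable def toOrbit (A : VonNeumannAlgebra H) (Ω : H) : A.toStarSubalgebra →ₗ[ℂ] orbit A Ω :=
  (orbitMap A Ω).codRestrict _ fun a => apply_mem_orbit a.2

theorem denseRange_toOrbit : DenseRange (toOrbit A Ω) := by
  intro x
  rw [closure_subtype]
  refine closure_mono ?_ x.2
  rintro _ ⟨a, rfl⟩
  exact ⟨_, ⟨a, rfl⟩, rfl⟩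

theorem orbit_induction {p : orbit A Ω → Prop} (hp : IsClosed {x | p x})
    (h : ∀ a (ha : a ∈ A), p ⟨a Ω, apply_mem_orbit ha⟩) (x : orbit A Ω) : p x :=
  denseRange_toOrbit.induction_on x hp fun a => h a a.2

/-- The restriction of `a ∈ A` to the closure of `A Ω`. -/
noncomputable def restrictOrbit {a : H →L[ℂ] H} (ha : a ∈ A) : orbit A Ω →L[ℂ] orbit A Ω :=
  (a.comp (orbit A Ω).subtypeL).codRestrict _ fun x => mem_orbit_of_mem ha x.2

/-- A closed subspace that contains a cyclic vector and reduces the generating algebras is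
everything. -/
theorem dense_of_invariant {B : VonNeumannAlgebra H} (hcyc : IsCyclic (join A B) Ω)
    (Z : Submodule ℂ H) (hZ : IsClosed (Z : Set H)) (hΩ : Ω ∈ Z)
    (hA : ∀ a ∈ A, ∀ x ∈ Z, a x ∈ Z) (hB : ∀ b ∈ B, ∀ x ∈ Z, b x ∈ Z) (x : H) : x ∈ Z := by
  have : CompleteSpace Z := hZ.completeSpace_coe
  have key : ∀ a : H →L[ℂ] H, (∀ x ∈ Z, a x ∈ Z) → (∀ x ∈ Z, (star a) x ∈ Z) →
      a * Z.starProjection = Z.starProjection * a := by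
    intro a ha ha'
    ext x
    change a (Z.starProjection x) = Z.starProjection (a x)
    refine (Submodule.eq_starProjection_of_mem_orthogonal
      (ha _ (Z.starProjection_apply_mem x)) ?_).symm
    rw [← map_sub, Submodule.mem_orthogonal]
    intro u hu
    rw [← star_apply_inner]
    exact (Z.mem_orthogonal _).1 (Z.sub_starProjection_mem_orthogonal x) _ (ha' u hu)
  -- The projection onto `Z` commutes with both algebras, hence with their join, so `Z` contains `T
  -- Ω` for every `T` in the join.
  have hE : Z.starProjection ∈ (join A B).commutant :=
    mem_commutant_join.2
      ⟨mem_commutant.2 fun a ha => key a (hA a ha) (hA _ (star_mem ha)),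
        mem_commutant.2 fun a ha => key a (hB a ha) (hB _ (star_mem ha))⟩
  refine closure_minimal ?_ hZ (hcyc x)
  rintro _ ⟨T, hT, rfl⟩
  have h1 := congrArg (fun S : H →L[ℂ] H => S Ω) (mem_commutant.1 hE T hT)
  change T (Z.starProjection Ω) = Z.starProjection (T Ω) at h1
  rw [Submodule.starProjection_eq_self_iff.2 hΩ] at h1
  rw [h1]
  exact Z.starProjection_apply_mem _

/-- A vector with product state on two commuting algebras gives a tensor product decomposition. -/
theorem exists_tensor {B : VonNeumannAlgebra H} (hcomm : ∀ a ∈ A, ∀ b ∈ B, a * b = b * a)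
    (hcyc : IsCyclic (join A B) Ω)
    (hprod : ∀ a ∈ A, ∀ b ∈ B, ⟪Ω, a (b Ω)⟫_ℂ = ⟪Ω, a Ω⟫_ℂ * ⟪Ω, b Ω⟫_ℂ) :
    ∃ (m : orbit A Ω →ₗ[ℂ] orbit B Ω →ₗ[ℂ] H) (hm : IsHilbertTensor m),
      m ⟨Ω, self_mem_orbit⟩ ⟨Ω, self_mem_orbit⟩ = Ω ∧
      (∀ T (hT : T ∈ A), T = hm.ampl (restrictOrbit hT)) ∧
      (∀ T (hT : T ∈ B), T = hm.flip.ampl (restrictOrbit hT)) ∧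
      IsCyclic (hm.reduce A) ⟨Ω, self_mem_orbit⟩ ∧
      IsCyclic (hm.flip.reduce B) ⟨Ω, self_mem_orbit⟩ := by
  have happ : ∀ a ∈ A, ∀ b ∈ B, ∀ x, a (b x) = b (a x) := fun a ha b hb x =>
    congrArg (fun S : H →L[ℂ] H => S x) (hcomm a ha b hb)
  -- The product property for `a* a'` and `b* b'` makes the Gram matrix of the vectors `b a Ω` that
  -- of a tensor product.
  have hin : ∀ a ∈ A, ∀ a' ∈ A, ∀ b ∈ B, ∀ b' ∈ B,
      ⟪b (a Ω), b' (a' Ω)⟫_ℂ = ⟪a Ω, a' Ω⟫_ℂ * ⟪b Ω, b' Ω⟫_ℂ := by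
    intro a ha a' ha' b hb b' hb'
    have := hprod (star a * a') (mul_mem (star_mem ha) ha') (star b * b')
      (mul_mem (star_mem hb) hb')
    change ⟪Ω, (star a) (a' ((star b) (b' Ω)))⟫_ℂ
      = ⟪Ω, (star a) (a' Ω)⟫_ℂ * ⟪Ω, (star b) (b' Ω)⟫_ℂ at this
    rw [happ a' ha' _ (star_mem hb), happ a' ha' _ hb', inner_star_apply, inner_star_apply,
      inner_star_apply, inner_star_apply, ← happ a ha b hb] at this
    rw [← happ a ha b hb, this]
  let f : B.toStarSubalgebra →ₗ[ℂ] (orbit A Ω →L[ℂ] H) :=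
    { toFun := fun b => (b : H →L[ℂ] H).comp (orbit A Ω).subtypeL
      map_add' := fun _ _ => rfl
      map_smul' := fun _ _ => rfl }
  -- On the closure of `A Ω` the operator `b` scales norms by exactly `‖b Ω‖`, so it depends only on
  -- `b Ω` and extends to limits of such vectors.
  have hfn : ∀ b h, ‖f b h‖ ≤ ‖toOrbit B Ω b‖ * ‖h‖ := by
    intro b h
    refine orbit_induction (p := fun h => ‖f b h‖ ≤ ‖toOrbit B Ω b‖ * ‖h‖)
      (isClosed_le (by fun_prop) (by fun_prop)) (fun a ha => ?_) h
    change ‖(b : H →L[ℂ] H) (a Ω)‖ ≤ ‖(b : H →L[ℂ] H) Ω‖ * ‖a Ω‖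
    have := hin a ha a ha b b.2 b b.2
    rw [inner_self_eq_ofReal, inner_self_eq_ofReal, inner_self_eq_ofReal] at this
    have h2 : ‖(b : H →L[ℂ] H) (a Ω)‖ ^ 2 = (‖(b : H →L[ℂ] H) Ω‖ * ‖a Ω‖) ^ 2 := by
      rw [mul_pow, mul_comm (‖(b : H →L[ℂ] H) Ω‖ ^ 2)]
      exact_mod_cast this
    exact ((pow_left_inj₀ (norm_nonneg _) (by positivity) two_ne_zero).1 h2).le
  obtain ⟨L, hL'⟩ := exists_bilinear_extension f (toOrbit B Ω) denseRange_toOrbit hfn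
  have hL : ∀ b (hb : b ∈ B) h, L ⟨b Ω, apply_mem_orbit hb⟩ h = b h := fun b hb h =>
    hL' ⟨b, hb⟩ h
  let m : orbit A Ω →ₗ[ℂ] orbit B Ω →ₗ[ℂ] H := LinearMap.mk₂ ℂ (fun h k => L k h)
    (fun _ _ _ => by simp) (fun _ _ _ => by simp) (fun _ _ _ => by simp) (fun _ _ _ => by simp)
  have hmL : ∀ h k, m h k = L k h := fun _ _ => rfl
  have c₁ : ∀ k, Continuous fun h => m h k := fun k => (L k).continuous
  have c₂ : ∀ h, Continuous fun k => m h k := fun h => by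
    simp only [hmL]; fun_prop
  have hmb : ∀ h b (hb : b ∈ B), m h ⟨b Ω, apply_mem_orbit hb⟩ = b h := fun h b hb => hL b hb h
  have hleft : ∀ a (ha : a ∈ A) h k, a (m h k) = m (restrictOrbit ha h) k := by
    intro a ha h k
    refine orbit_induction (p := fun k => a (m h k) = m (restrictOrbit ha h) k)
      (isClosed_eq (a.continuous.comp (c₂ _)) (c₂ _)) (fun b hb => ?_) k
    rw [hmb _ _ hb, hmb _ _ hb]
    exact happ a ha b hb h
  have hright : ∀ b (hb : b ∈ B) h k, b (m h k) = m h (restrictOrbit hb k) := by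
    intro b hb h k
    refine orbit_induction (p := fun k => b (m h k) = m h (restrictOrbit hb k))
      (isClosed_eq (b.continuous.comp (c₂ _)) ((c₂ _).comp (restrictOrbit hb).continuous))
      (fun b' hb' => ?_) k
    rw [hmb _ _ hb']
    exact (hmb h (b * b') (mul_mem hb hb')).symm
  have hΩ : m ⟨Ω, self_mem_orbit⟩ ⟨Ω, self_mem_orbit⟩ = Ω :=
    hmb ⟨Ω, self_mem_orbit⟩ 1 (one_mem B)
  have hm : IsHilbertTensor m := by
    constructor
    · intro h k h' k'
      refine orbit_induction (p := fun h => ⟪m h k, m h' k'⟫_ℂ = ⟪h, h'⟫_ℂ * ⟪k, k'⟫_ℂ)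
        (isClosed_eq ((c₁ _).inner continuous_const) (by fun_prop)) (fun a ha => ?_) h
      refine orbit_induction (p := fun k => ⟪m _ k, m h' k'⟫_ℂ = ⟪_, h'⟫_ℂ * ⟪k, k'⟫_ℂ)
        (isClosed_eq ((c₂ _).inner continuous_const) (by fun_prop)) (fun b hb => ?_) k
      refine orbit_induction (p := fun h' => ⟪m _ _, m h' k'⟫_ℂ = ⟪_, h'⟫_ℂ * ⟪_, k'⟫_ℂ)
        (isClosed_eq (continuous_const.inner (c₁ _)) (by fun_prop)) (fun a' ha' => ?_) h'
      refine orbit_induction (p := fun k' => ⟪m _ _, m _ k'⟫_ℂ = ⟪_, _⟫_ℂ * ⟪_, k'⟫_ℂ)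
        (isClosed_eq (continuous_const.inner (c₂ _)) (by fun_prop)) (fun b' hb' => ?_) k'
      rw [hmb _ _ hb, hmb _ _ hb']
      exact hin a ha a' ha' b hb b' hb'
    · have hs : ∀ T : H →L[ℂ] H, (∀ h k, ∃ h' k', T (m h k) = m h' k') →
          ∀ x ∈ (Submodule.span ℂ {x | ∃ h k, m h k = x}).topologicalClosure,
          T x ∈ (Submodule.span ℂ {x | ∃ h k, m h k = x}).topologicalClosure := by
        intro T hT x hx
        refine map_mem_closure T.continuous hx fun y hy => ?_
        induction hy using Submodule.span_induction with
        | mem y hy =>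
          obtain ⟨h, k, rfl⟩ := hy
          obtain ⟨h', k', e⟩ := hT h k
          rw [e]
          exact Submodule.subset_span ⟨h', k', rfl⟩
        | zero => rw [map_zero]; exact Submodule.zero_mem _
        | add x y _ _ hx hy => rw [map_add]; exact Submodule.add_mem _ hx hy
        | smul c x _ hx => rw [map_smul]; exact Submodule.smul_mem _ _ hx
      have hΩZ : Ω ∈ (Submodule.span ℂ {x | ∃ h k, m h k = x}).topologicalClosure :=
        Submodule.le_topologicalClosure _ (Submodule.subset_span ⟨_, _, hΩ⟩)
      exact fun x => dense_of_invariant hcyc _ (Submodule.isClosed_topologicalClosure _) hΩZ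
        (fun a ha => hs a fun h k => ⟨_, _, hleft a ha h k⟩)
        (fun b hb => hs b fun h k => ⟨_, _, hright b hb h k⟩) x
  have hA : ∀ T (hT : T ∈ A), T = hm.ampl (restrictOrbit hT) := fun T hT =>
    hm.eq_ampl (hleft T hT)
  have hB : ∀ T (hT : T ∈ B), T = hm.flip.ampl (restrictOrbit hT) := fun T hT =>
    hm.flip.eq_ampl fun k h => hright T hT h k
  refine ⟨m, hm, hΩ, hA, hB, ?_, ?_⟩
  · refine Dense.mono ?_ (denseRange_toOrbit (A := A) (Ω := Ω))
    rintro _ ⟨⟨a, ha⟩, rfl⟩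
    exact ⟨restrictOrbit ha, hm.mem_reduce.2 (by rw [← hA a ha]; exact ha), rfl⟩
  · refine Dense.mono ?_ (denseRange_toOrbit (A := B) (Ω := Ω))
    rintro _ ⟨⟨b, hb⟩, rfl⟩
    exact ⟨restrictOrbit hb, hm.flip.mem_reduce.2 (by rw [← hB b hb]; exact hb), rfl⟩

end Orbit

/-! ### Pure states and minimal projections -/

section Purity

variable {H : Type u} [NormedAddCommGroup H] [InnerProductSpace ℂ H] [CompleteSpace H]

theorem eq_zero_of_forall_nonneg {w k : ℝ} (h : ∀ t : ℝ, 0 ≤ w + t * k) : k = 0 := by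
  by_contra hk
  have := h (-(w + 1) / k)
  rw [div_mul_cancel₀ _ hk] at this
  linarith

/-- The Cauchy-Schwarz inequality for states, in the degenerate case. -/
theorem state_mul_eq_zero {M : VonNeumannAlgebra H} {ψ : M.toStarSubalgebra →ₗ[ℂ] ℂ}
    (hψ : ψ ∈ states M) {q : M.toStarSubalgebra} (hq : ψ (star q * q) = 0)
    (x : M.toStarSubalgebra) : ψ (star x * q) = 0 ∧ ψ (star q * x) = 0 := by
  have key : ∀ c : ℂ, ψ (star (x + c • q) * (x + c • q))
      = ψ (star x * x) + c * ψ (star x * q) + conj c * ψ (star q * x) := by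
    intro c
    have : star (x + c • q) * (x + c • q) = star x * x + c • (star x * q)
        + conj c • (star q * x) + (conj c * c) • (star q * q) := by
      rw [star_add, star_smul, add_mul, mul_add, mul_add, mul_smul_comm, smul_mul_assoc,
        smul_mul_assoc, mul_smul_comm, smul_smul]
      simp only [Complex.star_def]
      abel
    rw [this, map_add, map_add, map_add, map_smul, map_smul, map_smul, hq]
    simp
  have h0 := (hψ.2 x).2
  have hre : ∀ c : ℂ, 0 ≤ (ψ (star x * x) + c * ψ (star x * q) + conj c * ψ (star q * x)).re :=
    fun c => by rw [← key]; exact (hψ.2 _).1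
  have him : ∀ c : ℂ, (ψ (star x * x) + c * ψ (star x * q) + conj c * ψ (star q * x)).im = 0 :=
    fun c => by rw [← key]; exact (hψ.2 _).2
  set u := ψ (star x * q)
  set v := ψ (star q * x)
  -- Reality at `c = 1` and `c = i`, with nonnegativity along the lines `c = t` and `c = t i`, gives
  -- four linear equations that annihilate `u` and `v`.
  have a1 := him 1
  have a2 := him Complex.I
  have b1 : u.re + v.re = 0 := eq_zero_of_forall_nonneg (w := (ψ (star x * x)).re) fun t => by
    have := hre t
    simp at this
    linarith
  have b2 : v.im - u.im = 0 := eq_zero_of_forall_nonneg (w := (ψ (star x * x)).re) fun t => by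
    have := hre (t * Complex.I)
    simp at this
    linarith
  simp [h0] at a1 a2
  constructor <;> apply Complex.ext <;> simp <;> linarith

/-- A vector state supported by a minimal projection is pure. -/
theorem isPureState_of_minimal {M : VonNeumannAlgebra H} {Ω : H} (hΩ : ‖Ω‖ = 1)
    {p : M.toStarSubalgebra} (hp : star p = p) (hpp : p * p = p) (hpΩ : (p : H →L[ℂ] H) Ω = Ω)
    (hmin : ∀ T, p * T * p = vectorState M Ω T • p) :
    IsPureState M (vectorState M Ω) := by
  have hΩΩ : ⟪Ω, Ω⟫_ℂ = 1 := by rw [inner_self_eq_ofReal, hΩ]; simp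
  have hpv : vectorState M Ω p = 1 := by
    change ⟪Ω, (p : H →L[ℂ] H) Ω⟫_ℂ = 1
    rw [hpΩ, hΩΩ]
  have h1v : vectorState M Ω 1 = 1 := hΩΩ
  have hst : vectorState M Ω ∈ states M := by
    refine ⟨h1v, fun a => ?_⟩
    have : vectorState M Ω (star a * a) = ((‖(a : H →L[ℂ] H) Ω‖ ^ 2 : ℝ) : ℂ) := by
      rw [← inner_self_eq_ofReal]
      exact inner_star_apply (a : H →L[ℂ] H) Ω ((a : H →L[ℂ] H) Ω)
    rw [this, Complex.ofReal_re, Complex.ofReal_im]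
    exact ⟨by positivity, rfl⟩
  have hq : star (1 - p) * (1 - p) = 1 - p := by
    rw [star_sub, star_one, hp, mul_sub, mul_one, sub_mul, one_mul, hpp, sub_self, sub_zero]
  have huniq : ∀ ψ ∈ states M, ψ (1 - p) = 0 → ψ = vectorState M Ω := by
    intro ψ hψ h0
    rw [← hq] at h0
    have hp1 : ψ p = 1 := by
      rw [hq, map_sub, hψ.1, sub_eq_zero] at h0
      exact h0.symm
    ext T
    -- Cauchy–Schwarz against `1 - p` gives `ψ T = ψ (T p) = ψ (p T p)`, and minimality evaluates
    -- the last term.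
    have e1 := (state_mul_eq_zero hψ h0 (star T)).1
    have e2 := (state_mul_eq_zero hψ h0 (T * p)).2
    rw [star_star, mul_sub, mul_one, map_sub, sub_eq_zero] at e1
    rw [star_sub, star_one, hp, sub_mul, one_mul, map_sub, sub_eq_zero, ← mul_assoc, hmin,
      map_smul, hp1, smul_eq_mul, mul_one] at e2
    rw [e1, e2]
  rw [IsPureState, mem_extremePoints_iff_left]
  refine ⟨hst, fun ψ₁ h₁ ψ₂ h₂ hseg => ?_⟩
  obtain ⟨s, t, hs, ht, hst1, hcomb⟩ := hseg
  refine huniq ψ₁ h₁ ?_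
  -- The vector state vanishes on `1 - p`; as both components are nonnegative there and have
  -- positive weights, both vanish.
  have hc : s • ψ₁ (1 - p) + t • ψ₂ (1 - p) = 0 := by
    have := congrArg (fun χ : M.toStarSubalgebra →ₗ[ℂ] ℂ => χ (1 - p)) hcomb
    simp only [LinearMap.add_apply, LinearMap.smul_apply] at this
    rw [this, map_sub, h1v, hpv, sub_self]
  have a1 := h₁.2 (1 - p)
  have a2 := h₂.2 (1 - p)
  rw [hq] at a1 a2
  have hr := congrArg Complex.re hc
  simp only [Complex.add_re, Complex.smul_re, smul_eq_mul, Complex.zero_re] at hr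
  apply Complex.ext
  · have n1 := mul_nonneg hs.le a1.1
    have n2 := mul_nonneg ht.le a2.1
    have : s * (ψ₁ (1 - p)).re = 0 := by linarith
    exact (mul_eq_zero.1 this).resolve_left hs.ne'
  · exact a1.2

end Purity

/-! ### Purity, entropy and transport of the modular data -/

section Product

variable {H₁ H₂ H : Type u} [NormedAddCommGroup H₁] [InnerProductSpace ℂ H₁] [CompleteSpace H₁]
  [NormedAddCommGroup H₂] [InnerProductSpace ℂ H₂] [CompleteSpace H₂]
  [NormedAddCommGroup H] [InnerProductSpace ℂ H] [CompleteSpace H]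
  {m : H₁ →ₗ[ℂ] H₂ →ₗ[ℂ] H}

namespace IsHilbertTensor

theorem ampl_one (hm : IsHilbertTensor m) : hm.ampl 1 = 1 :=
  (hm.eq_ampl fun _ _ => rfl).symm

/-- The algebra of the operators `a ⊗ 1` is isomorphic to the algebra of all bounded operators. -/
theorem exists_starAlgEquiv (hm : IsHilbertTensor m) {M : VonNeumannAlgebra H}
    (hM : ∀ T, T ∈ M ↔ ∃ a, T = hm.ampl a) {k : H₂} (hk : k ≠ 0) :
    ∃ π : (H₁ →L[ℂ] H₁) ≃⋆ₐ[ℂ] M.toStarSubalgebra, ∀ a, (π a : H →L[ℂ] H) = hm.ampl a := by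
  let φ : (H₁ →L[ℂ] H₁) →⋆ₐ[ℂ] M.toStarSubalgebra :=
    { toFun := fun a => ⟨hm.ampl a, (hM _).2 ⟨a, rfl⟩⟩
      map_one' := Subtype.ext hm.ampl_one
      map_mul' := fun a b => Subtype.ext (hm.ampl_mul a b)
      map_zero' := Subtype.ext (by
        have := hm.ampl_smul 0 0
        rw [zero_smul, zero_smul] at this
        exact this)
      map_add' := fun a b => Subtype.ext (hm.ampl_add a b)
      commutes' := fun c => Subtype.ext (by
        change hm.ampl (algebraMap ℂ _ c) = algebraMap ℂ _ c
        rw [Algebra.algebraMap_eq_smul_one, Algebra.algebraMap_eq_smul_one, hm.ampl_smul,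
          hm.ampl_one])
      map_star' := fun a => Subtype.ext (hm.ampl_star a) }
  refine ⟨StarAlgEquiv.ofBijective φ ⟨fun a b hab => ?_, fun T => ?_⟩, fun a => rfl⟩
  · exact hm.ampl_injective hk (congrArg Subtype.val hab)
  · obtain ⟨a, ha⟩ := (hM _).1 T.2
    exact ⟨a, Subtype.ext ha.symm⟩

/-- The minimal projection is `|Ω₁⟩⟨Ω₁| ⊗ 1`, for which `p (a ⊗ 1) p = ⟪Ω₁, a Ω₁⟫ p`. -/
theorem isPureState (hm : IsHilbertTensor m) {M : VonNeumannAlgebra H}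
    (hM : ∀ T, T ∈ M ↔ ∃ a, T = hm.ampl a) {Ω₁ : H₁} {Ω₂ : H₂} (h₁ : ‖Ω₁‖ = 1) (h₂ : ‖Ω₂‖ = 1) :
    IsPureState M (vectorState M (m Ω₁ Ω₂)) := by
  have e₁ : ⟪Ω₁, Ω₁⟫_ℂ = 1 := by rw [inner_self_eq_ofReal, h₁]; simp
  have e₂ : ⟪Ω₂, Ω₂⟫_ℂ = 1 := by rw [inner_self_eq_ofReal, h₂]; simp
  let p : H₁ →L[ℂ] H₁ := InnerProductSpace.rankOne ℂ Ω₁ Ω₁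
  have hp : ∀ x, p x = ⟪Ω₁, x⟫_ℂ • Ω₁ := fun x => by simp [p]
  refine isPureState_of_minimal (p := ⟨hm.ampl p, (hM _).2 ⟨p, rfl⟩⟩) ?_ ?_ ?_ ?_ ?_
  · rw [hm.norm_apply, h₁, h₂, one_mul]
  · refine Subtype.ext ?_
    change star (hm.ampl p) = hm.ampl p
    rw [← hm.ampl_star]
    congr 1
    ext x
    refine ext_inner_right ℂ fun y => ?_
    rw [star_apply_inner, hp, hp, inner_smul_left, inner_smul_right, inner_conj_symm, mul_comm]
  · refine Subtype.ext ?_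
    change hm.ampl p * hm.ampl p = hm.ampl p
    rw [← hm.ampl_mul]
    congr 1
    ext x
    change p (p x) = p x
    rw [hp x, map_smul, hp, e₁, one_smul]
  · change hm.ampl p (m Ω₁ Ω₂) = _
    rw [hm.ampl_apply, hp, e₁, one_smul]
  · rintro ⟨T, hT⟩
    obtain ⟨a, rfl⟩ := (hM _).1 hT
    refine Subtype.ext ?_
    change hm.ampl p * hm.ampl a * hm.ampl p
      = ⟪m Ω₁ Ω₂, hm.ampl a (m Ω₁ Ω₂)⟫_ℂ • hm.ampl p
    rw [← hm.ampl_mul, ← hm.ampl_mul, ← hm.ampl_smul, hm.ampl_apply, hm.inner_eq, e₂, mul_one]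
    congr 1
    ext x
    change p (a (p x)) = ⟪Ω₁, a Ω₁⟫_ℂ • p x
    rw [hp x, map_smul, map_smul, hp, smul_comm]

/-- The density matrix is `|Ω₁⟩⟨Ω₁|`: in an orthonormal basis through `Ω₁` its eigenvalues are `1`
once and `0` otherwise, and `-p log p` vanishes at both. -/
theorem hasEntropy_zero (hm : IsHilbertTensor m) {M : VonNeumannAlgebra H}
    (hM : ∀ T, T ∈ M ↔ ∃ a, T = hm.ampl a) {Ω₁ : H₁} {Ω₂ : H₂} (h₁ : ‖Ω₁‖ = 1) (h₂ : ‖Ω₂‖ = 1) :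
    HasEntropy M (vectorState M (m Ω₁ Ω₂)) 0 := by
  classical
  have e₂ : ⟪Ω₂, Ω₂⟫_ℂ = 1 := by rw [inner_self_eq_ofReal, h₂]; simp
  have hk : Ω₂ ≠ 0 := fun h0 => by rw [h0, norm_zero] at h₂; exact zero_ne_one h₂
  obtain ⟨π, hπ⟩ := hm.exists_starAlgEquiv hM hk
  have ho : Orthonormal ℂ ((↑) : ({Ω₁} : Set H₁) → H₁) := by
    constructor
    · rintro ⟨x, rfl⟩
      exact h₁
    · rintro ⟨x, rfl⟩ ⟨y, rfl⟩ hxy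
      exact absurd rfl hxy
  obtain ⟨w, b, hw, hb⟩ := ho.exists_hilbertBasis_extension
  let i₀ : w := ⟨Ω₁, hw rfl⟩
  have hbi : b i₀ = Ω₁ := by rw [hb]
  let p : w → ℝ := fun i => if i = i₀ then 1 else 0
  have hpi : ∀ i, i ≠ i₀ → p i = 0 := fun i hi => if_neg hi
  have hp0 : p i₀ = 1 := if_pos rfl
  refine ⟨H₁, inferInstance, inferInstance, inferInstance, π, w, b, p, fun i => ?_, ?_, ?_, ?_⟩
  · simp only [p]
    split_ifs <;> norm_num
  · exact hasSum_ite_eq i₀ 1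
  · intro T
    have : vectorState M (m Ω₁ Ω₂) (π T) = (p i₀ : ℂ) * ⟪b i₀, T (b i₀)⟫_ℂ := by
      change ⟪m Ω₁ Ω₂, (π T : H →L[ℂ] H) (m Ω₁ Ω₂)⟫_ℂ = _
      rw [hπ, hm.ampl_apply, hm.inner_eq, e₂, hbi, hp0]
      simp
    rw [this]
    refine hasSum_single i₀ fun i hi => ?_
    rw [hpi i hi]
    simp
  · symm
    refine ENNReal.tsum_eq_zero.2 fun i => ?_
    by_cases hi : i = i₀
    · rw [hi, hp0, Real.negMulLog_one, ENNReal.ofReal_zero]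
    · rw [hpi i hi, Real.negMulLog_zero, ENNReal.ofReal_zero]

theorem eq_leftAmpl (hm : IsHilbertTensor m) {W : HilbertTensor H₁ H₂ ≃ₗᵢ[ℂ] H}
    (hW : ∀ h k, W (tmul h k) = m h k) {A : VonNeumannAlgebra H}
    (hA : ∀ T ∈ A, ∃ a, T = hm.ampl a) :
    (A : Set (H →L[ℂ] H)) = leftAmpl W (hm.reduce A : Set (H₁ →L[ℂ] H₁)) := by
  ext T
  constructor
  · intro hT
    obtain ⟨a, rfl⟩ := hA T hT
    exact ⟨a, hm.mem_reduce.2 hT, fun x y => by rw [hW, hW, hm.ampl_apply]⟩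
  · rintro ⟨a, ha, h⟩
    rw [hm.eq_ampl (T := T) (a := a) fun x y => by rw [← hW, h, hW]]
    exact hm.mem_reduce.1 ha

theorem eq_rightAmpl (hm : IsHilbertTensor m) {W : HilbertTensor H₁ H₂ ≃ₗᵢ[ℂ] H}
    (hW : ∀ h k, W (tmul h k) = m h k) {A : VonNeumannAlgebra H}
    (hA : ∀ T ∈ A, ∃ a, T = hm.flip.ampl a) :
    (A : Set (H →L[ℂ] H)) = rightAmpl W (hm.flip.reduce A : Set (H₂ →L[ℂ] H₂)) := by
  ext T
  constructor
  · intro hT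
    obtain ⟨a, rfl⟩ := hA T hT
    exact ⟨a, hm.flip.mem_reduce.2 hT, fun x y => by rw [hW, hW, hm.flip_ampl_apply]⟩
  · rintro ⟨a, ha, h⟩
    rw [hm.flip.eq_ampl (T := T) (a := a) fun x y => by
      rw [LinearMap.flip_apply, ← hW, h, hW, LinearMap.flip_apply]]
    exact hm.flip.mem_reduce.1 ha

end IsHilbertTensor

/-- By `of_sandwich` the conjugated algebra `J₁ N₁ J₁` has the modular data of `N₁'`, where `N₁` is
the reduction of `A`. The vector is cyclic for `N₁'`, hence separating for `N₁`, and `J₁` transports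
this to `J₁ N₁ J₁`. -/
theorem IsProductModular.reduce_conjugate {A B : VonNeumannAlgebra H} {Ω₁ : H₁} {Ω₂ : H₂}
    {J : H ≃ₗᵢ⋆[ℂ] H} {G : Set (H × H)} (h : IsProductModular m A B Ω₁ Ω₂ J G)
    {J₁ : H₁ ≃ₗᵢ⋆[ℂ] H₁} {J₂ : H₂ ≃ₗᵢ⋆[ℂ] H₂} (hJ₁ : ∀ x, m (J₁ x) Ω₂ = J (m x Ω₂))
    (hJ : ∀ x y, J (m x y) = m (J₁ x) (J₂ y)) (hJ₂ : ∀ y, J₂ (J₂ y) = y) :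
    IsCyclic (h.tensor.reduce (conjugate J A)) Ω₁ ∧
      IsSeparating (h.tensor.reduce (conjugate J A)) Ω₁ ∧
      IsModularConjugation (h.tensor.reduce (conjugate J A)) Ω₁ J₁ ∧
      sandwich J₁ '' (h.tensor.reduce (conjugate J A) : Set (H₁ →L[ℂ] H₁))
        = h.tensor.reduce A := by
  have r := h.isModularRel_left hJ₁
  have hmem := h.mem_reduce_conjugate hJ hJ₂
  have r' := r.of_sandwich hmem
  have hJJ := r.apply_apply
  refine ⟨r'.dense_orbit, fun a ha h0 => ?_, r'.isModularConjugation, ?_⟩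
  · have hs := r.dense_orbit.isSeparating (N := h.tensor.reduce A)
      (fun c hc b hb => (mem_commutant.1 hc b hb).symm)
    have := hs _ ((hmem a).1 ha) (by rw [sandwich_apply, r.apply_vector, h0, map_zero])
    rw [← sandwich_sandwich hJJ a, this]
    ext x
    simp [sandwich_apply]
  · ext a
    constructor
    · rintro ⟨b, hb, rfl⟩
      exact (hmem b).1 hb
    · intro ha
      refine ⟨sandwich J₁ a, (hmem _).2 ?_, sandwich_sandwich hJJ a⟩
      rwa [sandwich_sandwich hJJ]

end Product

end DoplicherLongo

theorem theorem7 {H : Type u} [NormedAddCommGroup H] [InnerProductSpace ℂ H] [CompleteSpace H]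
    (A₁ A₄ : VonNeumannAlgebra H) (hcomm : ∀ a ∈ A₁, ∀ b ∈ A₄, a * b = b * a)
    -- the vacuum vector
    (Ω₀ : H) (hΩ₀ : ‖Ω₀‖ = 1)
    (hsep₁ : DoplicherLongo.IsSeparating A₁ Ω₀) (hsep₄ : DoplicherLongo.IsSeparating A₄ Ω₀)
    -- the vector whose state restricts to the product of the vacua
    (Ω : H) (hcyc : DoplicherLongo.IsCyclic (DoplicherLongo.join A₁ A₄) Ω)
    (hprod : ∀ a ∈ A₁, ∀ b ∈ A₄, ⟪Ω, a (b Ω)⟫_ℂ = ⟪Ω₀, a Ω₀⟫_ℂ * ⟪Ω₀, b Ω₀⟫_ℂ)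
    -- the Doplicher-Longo construction
    (J₂₃ : H ≃ₗᵢ⋆[ℂ] H)
    (hJ₂₃ : DoplicherLongo.IsModularConjugation (DoplicherLongo.join A₁ A₄).commutant Ω J₂₃)
    (A₂ A₃ A₁₂ : VonNeumannAlgebra H) (hA₂ : A₂ = DoplicherLongo.conjugate J₂₃ A₁)
    (hA₃ : A₃ = DoplicherLongo.conjugate J₂₃ A₄) (hA₁₂ : A₁₂ = DoplicherLongo.join A₁ A₂)
    (hfactor : DoplicherLongo.IsFactor A₁₂) :
    DoplicherLongo.IsSeparating (DoplicherLongo.join A₁ A₄) Ω ∧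
    (∃ (H₁₂ H₃₄ : Type u)
      (_ : NormedAddCommGroup H₁₂) (_ : InnerProductSpace ℂ H₁₂) (_ : CompleteSpace H₁₂)
      (_ : NormedAddCommGroup H₃₄) (_ : InnerProductSpace ℂ H₃₄) (_ : CompleteSpace H₃₄)
      (W : DoplicherLongo.HilbertTensor H₁₂ H₃₄ ≃ₗᵢ[ℂ] H)
      (N₁ N₂ : VonNeumannAlgebra H₁₂) (N₃ N₄ : VonNeumannAlgebra H₃₄)
      (Ω₁₂ : H₁₂) (Ω₃₄ : H₃₄) (J₂ : H₁₂ ≃ₗᵢ⋆[ℂ] H₁₂) (J₃ : H₃₄ ≃ₗᵢ⋆[ℂ] H₃₄),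
      -- the identification of `H` with `H₁₂ ⊗ H₃₄`
      (A₁ : Set (H →L[ℂ] H)) = DoplicherLongo.leftAmpl W N₁ ∧
      (A₂ : Set (H →L[ℂ] H)) = DoplicherLongo.leftAmpl W N₂ ∧
      (A₃ : Set (H →L[ℂ] H)) = DoplicherLongo.rightAmpl W N₃ ∧
      (A₄ : Set (H →L[ℂ] H)) = DoplicherLongo.rightAmpl W N₄ ∧
      (A₁₂ : Set (H →L[ℂ] H)) = DoplicherLongo.leftAmpl W Set.univ ∧
      Ω = W (DoplicherLongo.tmul Ω₁₂ Ω₃₄) ∧ ‖Ω₁₂‖ = 1 ∧ ‖Ω₃₄‖ = 1 ∧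
      -- the modular conjugations of `A₂` and `A₃`
      DoplicherLongo.IsCyclic N₂ Ω₁₂ ∧ DoplicherLongo.IsSeparating N₂ Ω₁₂ ∧
      DoplicherLongo.IsModularConjugation N₂ Ω₁₂ J₂ ∧
      DoplicherLongo.IsCyclic N₃ Ω₃₄ ∧ DoplicherLongo.IsSeparating N₃ Ω₃₄ ∧
      DoplicherLongo.IsModularConjugation N₃ Ω₃₄ J₃ ∧
      -- the claims about the modular conjugations
      DoplicherLongo.IsTensorConj W J₂₃ J₂ J₃ ∧
      DoplicherLongo.sandwich J₂ '' (N₂ : Set (H₁₂ →L[ℂ] H₁₂)) = N₁ ∧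
      DoplicherLongo.sandwich J₃ '' (N₃ : Set (H₃₄ →L[ℂ] H₃₄)) = N₄) ∧
    -- purity and vanishing of the entropy
    DoplicherLongo.IsPureState A₁₂ (DoplicherLongo.vectorState A₁₂ Ω) ∧
    DoplicherLongo.HasEntropy A₁₂ (DoplicherLongo.vectorState A₁₂ Ω) 0 := by
  open DoplicherLongo in
  subst hA₁₂ hA₂ hA₃
  have hΩΩ₀ : ⟪Ω₀, Ω₀⟫_ℂ = 1 := by rw [inner_self_eq_ofReal, hΩ₀]; simp
  -- Normalisation of `Ω` is the product formula at `a = b = 1`; setting one operator to `1` also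
  -- rewrites the vacuum expectations in terms of `Ω`.
  have hΩ : ‖Ω‖ = 1 := by
    have := hprod 1 (one_mem _) 1 (one_mem _)
    change ⟪Ω, Ω⟫_ℂ = ⟪Ω₀, Ω₀⟫_ℂ * ⟪Ω₀, Ω₀⟫_ℂ at this
    rw [hΩΩ₀, inner_self_eq_ofReal, mul_one] at this
    have h2 : ‖Ω‖ ^ 2 = 1 := by exact_mod_cast this
    exact (pow_eq_one_iff_of_nonneg (norm_nonneg _) two_ne_zero).1 h2
  have hprod' : ∀ a ∈ A₁, ∀ b ∈ A₄, ⟪Ω, a (b Ω)⟫_ℂ = ⟪Ω, a Ω⟫_ℂ * ⟪Ω, b Ω⟫_ℂ := by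
    intro a ha b hb
    have h1 := hprod a ha 1 (one_mem _)
    have h2 := hprod 1 (one_mem _) b hb
    change ⟪Ω, a Ω⟫_ℂ = ⟪Ω₀, a Ω₀⟫_ℂ * ⟪Ω₀, Ω₀⟫_ℂ at h1
    change ⟪Ω, b Ω⟫_ℂ = ⟪Ω₀, Ω₀⟫_ℂ * ⟪Ω₀, b Ω₀⟫_ℂ at h2
    rw [hprod a ha b hb, h1, h2, hΩΩ₀, one_mul, mul_one]
  obtain ⟨G, hG⟩ := hJ₂₃.exists_rel
  -- The modular conjugation presupposes that `Ω` is cyclic for the commutant, hence separating for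
  -- `A₁ ∨ A₄`.
  have hsep : IsSeparating (join A₁ A₄) Ω := hG.dense_orbit.isSeparating
    (fun c hc b hb => (mem_commutant.1 hc b hb).symm)
  obtain ⟨m, hm, hmΩ, hA, hB, cyc₁, cyc₄⟩ := exists_tensor hcomm hcyc hprod'
  have h : IsProductModular m A₁ A₄ ⟨Ω, self_mem_orbit⟩ ⟨Ω, self_mem_orbit⟩ J₂₃ G :=
    ⟨hm, hΩ, hΩ, fun T hT => ⟨_, hA T hT⟩, fun T hT => ⟨_, hB T hT⟩, by rw [hmΩ]; exact hG⟩
  obtain ⟨J₂, hJ₂⟩ := h.exists_conj_left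
  obtain ⟨J₃, hJ₃⟩ := h.flip.exists_conj_left
  have hJ₂' := (h.isModularRel_left hJ₂).apply_apply
  have hJ₃' := (h.flip.isModularRel_left hJ₃).apply_apply
  have hJ := h.conj_tensor hJ₂ hJ₃
  have hJf : ∀ y x, J₂₃ (m.flip y x) = m.flip (J₃ y) (J₂ x) := fun y x => hJ x y
  obtain ⟨c₂, s₂, j₂, i₂⟩ := h.reduce_conjugate hJ₂ hJ hJ₃'
  obtain ⟨c₃, s₃, j₃, i₃⟩ := h.flip.reduce_conjugate hJ₃ hJf hJ₂'
  have hM := h.mem_join_conjugate hJ₂ hJ hJ₃' cyc₁ hfactor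
  obtain ⟨W, hW⟩ := hm.exists_unitary
  have hpure := hm.isPureState hM (Ω₁ := ⟨Ω, self_mem_orbit⟩) (Ω₂ := ⟨Ω, self_mem_orbit⟩) hΩ hΩ
  have hent := hm.hasEntropy_zero hM (Ω₁ := ⟨Ω, self_mem_orbit⟩) (Ω₂ := ⟨Ω, self_mem_orbit⟩) hΩ hΩ
  rw [hmΩ] at hpure hent
  refine ⟨hsep, ⟨orbit A₁ Ω, orbit A₄ Ω, inferInstance, inferInstance, inferInstance,
    inferInstance, inferInstance, inferInstance, W, _, _, _, _, ⟨Ω, self_mem_orbit⟩,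
    ⟨Ω, self_mem_orbit⟩, J₂, J₃, hm.eq_leftAmpl hW h.ampl_left,
    hm.eq_leftAmpl hW (h.conjugate_ampl hJ hJ₃'),
    hm.eq_rightAmpl hW (h.flip.conjugate_ampl hJf hJ₂'), hm.eq_rightAmpl hW h.ampl_right,
    ?_, ?_, hΩ, hΩ, c₂, s₂, j₂, c₃, s₃, j₃, ?_, i₂, i₃⟩, hpure, hent⟩
  · ext T
    change T ∈ join A₁ (conjugate J₂₃ A₁) ↔ _
    rw [hM]
    constructor
    · rintro ⟨a, rfl⟩
      exact ⟨a, trivial, fun x y => by rw [hW, hW, hm.ampl_apply]⟩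
    · rintro ⟨a, -, ha⟩
      exact ⟨a, hm.eq_ampl fun x y => by rw [← hW, ha, hW]⟩
  · rw [hW, hmΩ]
  · intro x y
    rw [hW, hW, hJ]
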